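/- Let $M$ be a nonempty closed (compact, Hausdorff, without boundary) smooth manifold of dimension $n\ge 3$, not necessarily connected, with a smooth Riemannian metric $g$. Put $a=\frac{4(n-1)}{n-2}$ and $p=\frac{2n}{n-2}$, let $S_g$ be the scalar curvature of $g$ (positive for round spheres), and let $\Delta_g=\operatorname{div}_g\operatorname{grad}_g=-d^*d$ be the Laplace–Beltrami operator. Assume $S_g\ge 0$ everywhere on $M$. Then: (1) There is a smooth function $H$ on $M$, negative at some point of $M$, and a smooth positive function $u$ on $M$ such that $H$ is the scalar curvature of the conformal metric $u^{p-2}g$, and such that $-a\Delta_g u+S_g u=Hu^{p-1}$ on $M$. (2) The two properties of $u$ in (1) are equivalent: for every smooth function $H$ and every smooth positive function $u$ on $M$, the function $H$ is the scalar curvature of $u^{p-2}g$ if and only if $-a\Delta_g u+S_g u=Hu^{p-1}$ on $M$. -/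

import Mathlib

open scoped Manifold ContDiff

noncomputable section

namespace ConformalScalar

/-! ### Riemannian geometry of a metric in coordinates on `ℝⁿ`

A metric in coordinates is a function `G` assigning to each point `y` the matrix
`(G_{ij}(y))`. -/

/-- The partial derivative `∂_i f` at the point `y`. -/
def pderiv {n : ℕ} (i : Fin n) (f : EuclideanSpace ℝ (Fin n) → ℝ)
    (y : EuclideanSpace ℝ (Fin n)) : ℝ :=
  fderiv ℝ f y (EuclideanSpace.single i 1)

/-- The Christoffel symbol
`Γ^k_{ij} = ½ ∑_l G^{kl} (∂_i G_{jl} + ∂_j G_{il} - ∂_l G_{ij})`. -/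
def christoffel {n : ℕ} (G : EuclideanSpace ℝ (Fin n) → Matrix (Fin n) (Fin n) ℝ)
    (k i j : Fin n) (y : EuclideanSpace ℝ (Fin n)) : ℝ :=
  (1 / 2 : ℝ) * ∑ l, (G y)⁻¹ k l *
    (pderiv i (fun z => G z j l) y + pderiv j (fun z => G z i l) y
      - pderiv l (fun z => G z i j) y)

/-- The components `R^l_{ijk}` of the Riemann curvature tensor, that is
`R(∂_i, ∂_j) ∂_k = ∇_i ∇_j ∂_k - ∇_j ∇_i ∂_k = ∑_l R^l_{ijk} ∂_l`. -/
def riemann {n : ℕ} (G : EuclideanSpace ℝ (Fin n) → Matrix (Fin n) (Fin n) ℝ)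
    (l i j k : Fin n) (y : EuclideanSpace ℝ (Fin n)) : ℝ :=
  pderiv i (christoffel G l j k) y - pderiv j (christoffel G l i k) y
    + ∑ m, (christoffel G l i m y * christoffel G m j k y
        - christoffel G l j m y * christoffel G m i k y)

/-- The Ricci tensor `Ric_{jk} = ∑_i R^i_{ijk}`, i.e. `Ric(Y, Z) = tr (X ↦ R(X, Y) Z)`. -/
def ricci {n : ℕ} (G : EuclideanSpace ℝ (Fin n) → Matrix (Fin n) (Fin n) ℝ)
    (j k : Fin n) (y : EuclideanSpace ℝ (Fin n)) : ℝ :=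
  ∑ i, riemann G i i j k y

/-- The scalar curvature `∑_{j,k} G^{jk} Ric_{jk}` (positive for round spheres). -/
def coordScalar {n : ℕ} (G : EuclideanSpace ℝ (Fin n) → Matrix (Fin n) (Fin n) ℝ)
    (y : EuclideanSpace ℝ (Fin n)) : ℝ :=
  ∑ j, ∑ k, (G y)⁻¹ j k * ricci G j k y

/-- The Laplace–Beltrami operator (the trace of the covariant Hessian)
`∑_{i,j} G^{ij} (∂_i ∂_j f - ∑_k Γ^k_{ij} ∂_k f)`. -/
def coordLaplacian {n : ℕ} (G : EuclideanSpace ℝ (Fin n) → Matrix (Fin n) (Fin n) ℝ)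
    (f : EuclideanSpace ℝ (Fin n) → ℝ) (y : EuclideanSpace ℝ (Fin n)) : ℝ :=
  ∑ i, ∑ j, (G y)⁻¹ i j *
    (pderiv i (pderiv j f) y - ∑ k, christoffel G k i j y * pderiv k f y)

/-! ### Riemannian manifolds -/

/-- Smooth Riemannian metrics on a smooth `n`-manifold `M` without boundary. -/
abbrev SmoothMetric (n : ℕ) (M : Type*) [TopologicalSpace M]
    [ChartedSpace (EuclideanSpace ℝ (Fin n)) M] [IsManifold (𝓡 n) ∞ M] : Type _ :=
  Bundle.ContMDiffRiemannianMetric (𝓡 n) ∞ (EuclideanSpace ℝ (Fin n))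
    (fun x : M => TangentSpace (𝓡 n) x)

lemma contMDiff_rpow {n : ℕ} {M : Type*} [TopologicalSpace M]
    [ChartedSpace (EuclideanSpace ℝ (Fin n)) M] {u : M → ℝ} (hu : ContMDiff (𝓡 n) 𝓘(ℝ) ∞ u)
    (hpos : ∀ x, 0 < u x) (r : ℝ) : ContMDiff (𝓡 n) 𝓘(ℝ) ∞ (fun x => u x ^ r) := fun x =>
  ((Real.contDiffAt_rpow_const_of_ne (p := r) (hpos x).ne').contMDiffAt).comp x (hu x)

section

variable {n : ℕ} {M : Type*} [TopologicalSpace M]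
  [ChartedSpace (EuclideanSpace ℝ (Fin n)) M] [IsManifold (𝓡 n) ∞ M]

/-- The coefficients `G_{ij} = g(∂_i, ∂_j)` of the metric in the preferred chart `φ` at `x`, where
`∂_i = d(φ⁻¹)(e_i)` are the coordinate vector fields of `φ`. -/
def chartMetric (g : SmoothMetric n M) (x : M) (y : EuclideanSpace ℝ (Fin n)) :
    Matrix (Fin n) (Fin n) ℝ :=
  Matrix.of fun i j =>
    g.inner ((extChartAt (𝓡 n) x).symm y)
      (mfderiv 𝓘(ℝ, EuclideanSpace ℝ (Fin n)) (𝓡 n) (extChartAt (𝓡 n) x).symm y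
        (EuclideanSpace.single i (1 : ℝ)))
      (mfderiv 𝓘(ℝ, EuclideanSpace ℝ (Fin n)) (𝓡 n) (extChartAt (𝓡 n) x).symm y
        (EuclideanSpace.single j (1 : ℝ)))

/-- The scalar curvature `S_g` at `x`, computed in the chart at `x`. -/
def scalarCurvature (g : SmoothMetric n M) (x : M) : ℝ :=
  coordScalar (chartMetric g x) (extChartAt (𝓡 n) x x)

/-- The Laplace–Beltrami operator `Δ_g u = div grad u` at `x`, computed in the chart at `x`. -/
def laplacian (g : SmoothMetric n M) (u : M → ℝ) (x : M) : ℝ :=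
  coordLaplacian (chartMetric g x) (u ∘ (extChartAt (𝓡 n) x).symm) (extChartAt (𝓡 n) x x)

/-- The metric `φ g`, for a smooth positive function `φ`. -/
def rescale (g : SmoothMetric n M) (φ : M → ℝ) (hφ : ContMDiff (𝓡 n) 𝓘(ℝ) ∞ φ)
    (hpos : ∀ x, 0 < φ x) : SmoothMetric n M where
  inner x := φ x • g.inner x
  symm x v w := by
    change φ x * g.inner x v w = φ x * g.inner x w v
    rw [g.symm]
  pos x v hv := mul_pos (hpos x) (g.pos x v hv)
  isVonNBounded x := by
    have hs : 0 < √(φ x) := Real.sqrt_pos.2 (hpos x)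
    have h := (g.isVonNBounded x).image
      ((√(φ x))⁻¹ • ContinuousLinearMap.id ℝ (TangentSpace (𝓡 n) x))
    refine h.subset ?_
    intro v hv
    have hv' : φ x * g.inner x v v < 1 := hv
    refine ⟨√(φ x) • v, ?_, ?_⟩
    · change g.inner x (√(φ x) • v) (√(φ x) • v) < 1
      rw [map_smul, map_smul]
      change √(φ x) * (√(φ x) * g.inner x v v) < 1
      rw [← mul_assoc, Real.mul_self_sqrt (hpos x).le]
      exact hv'
    · change (√(φ x))⁻¹ • (√(φ x) • v) = v
      rw [smul_smul, inv_mul_cancel₀ hs.ne', one_smul]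
  contMDiff := hφ.smul_section g.contMDiff

/-- The constant `a = 4(n-1)/(n-2)`. -/
def yamabeA (n : ℕ) : ℝ := 4 * ((n : ℝ) - 1) / ((n : ℝ) - 2)

/-- The exponent `p = 2n/(n-2)`. -/
def yamabeP (n : ℕ) : ℝ := 2 * (n : ℝ) / ((n : ℝ) - 2)

/-- The conformal metric `u^{p-2} g`, for a smooth positive function `u`. -/
def conformalMetric (g : SmoothMetric n M) (u : M → ℝ) (hu : ContMDiff (𝓡 n) 𝓘(ℝ) ∞ u)
    (hpos : ∀ x, 0 < u x) : SmoothMetric n M :=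
  rescale g (fun x => u x ^ (yamabeP n - 2)) (contMDiff_rpow hu hpos _)
    (fun x => Real.rpow_pos_of_pos (hpos x) _)

end

end ConformalScalar

end

/-!
In a chart, the metric `g` is a smooth nondegenerate matrix field `G` on an open set of `ℝⁿ`
(`IsCoordMetric`), and everything reduces to two facts about the coordinate formulas and one
construction.

*Conformal change.* If `w = dφ / 2φ`, the Christoffel symbols of `φ G` are those of `G` plus the
tensor `C^k_{ij} = δ^k_j w_i + δ^k_i w_j - G_{ij} w^k`. Because the Levi-Civita connection is
metric, the covariant derivative of `C` is built in the same way from `∇w`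
(`covDeriv_confDiff`), and tracing the curvature twice gives
`S_{φG} = φ⁻¹ (S_G - 2(n-1) div w - (n-1)(n-2) |w|²)` (`coordScalar_conformal`).
With `φ = u^{p-2}` one has `w = (2/(n-2)) du/u`; the terms quadratic in `du` cancel, and what is
left is `S_{φG} u^{p-1} = -a Δu + S_G u` (`coordScalar_yamabe`). As `u > 0`, this pointwise
identity is the equivalence of the two properties of `u`.

*Invariance.* The scalar curvature at `x` is defined in the preferred chart at `x`, which varies
with `x`; that it is a smooth function on `M` therefore depends on its invariance under changes of
coordinates. In matrix form the transformation law of the Christoffel symbols reads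
`J Γ'_i = A_i J + ∂_i J`, where `J` is the Jacobian matrix and `A_i = ∑_c J^c_i Γ_c`
(`jacobian_mul_connMat`). Differentiating it and antisymmetrizing gives the law
`J R'_{ij} = (∑ J^a_i J^b_j R_{ab}) J` for the curvature (`jacobian_mul_curvMat`), and hence
`coordScalar_pullback` and `contMDiff_scalarCurvature`.

*A conformal factor.* Near a point `q` let `u = 1 + C |y - y(q)|²` in the chart at `q`, cut off by a
bump function. Then `u ≥ 1`, `u(q) = 1`, and `Δu(q) = 2 C tr G⁻¹` can be any number `≥ 0`. For
`Δu(q) = (S(q) + 1) / a` the scalar curvature of `u^{p-2} g` at `q` is `-1`, and it is smooth by the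
invariance; it is the required `H`.
-/

namespace ConformalScalar

open scoped Topology
open Bundle

/-! ### Partial derivatives -/

section

variable {n : ℕ} {U : Set (EuclideanSpace ℝ (Fin n))} {y : EuclideanSpace ℝ (Fin n)}
  {f g : EuclideanSpace ℝ (Fin n) → ℝ}

lemma pderiv_congr (i : Fin n) (h : f =ᶠ[𝓝 y] g) : pderiv i f y = pderiv i g y := by
  rw [pderiv, pderiv, h.fderiv_eq]

lemma pderiv_congr_of_eqOn (hU : IsOpen U) (hy : y ∈ U) (i : Fin n) (h : ∀ z ∈ U, f z = g z) :
    pderiv i f y = pderiv i g y :=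
  pderiv_congr i (Filter.eventuallyEq_of_mem (hU.mem_nhds hy) h)

lemma pderiv_add (i : Fin n) (hf : DifferentiableAt ℝ f y) (hg : DifferentiableAt ℝ g y) :
    pderiv i (fun z => f z + g z) y = pderiv i f y + pderiv i g y := by
  simp [pderiv, fderiv_fun_add hf hg]

lemma pderiv_sub (i : Fin n) (hf : DifferentiableAt ℝ f y) (hg : DifferentiableAt ℝ g y) :
    pderiv i (fun z => f z - g z) y = pderiv i f y - pderiv i g y := by
  simp [pderiv, fderiv_fun_sub hf hg]

lemma pderiv_mul (i : Fin n) (hf : DifferentiableAt ℝ f y) (hg : DifferentiableAt ℝ g y) :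
    pderiv i (fun z => f z * g z) y = pderiv i f y * g y + f y * pderiv i g y := by
  simp [pderiv, fderiv_fun_mul hf hg]; ring

lemma pderiv_const_mul (i : Fin n) (c : ℝ) (hf : DifferentiableAt ℝ f y) :
    pderiv i (fun z => c * f z) y = c * pderiv i f y := by
  simp [pderiv, fderiv_const_mul hf]

lemma pderiv_sum {ι : Type*} (s : Finset ι) (i : Fin n) {F : ι → EuclideanSpace ℝ (Fin n) → ℝ}
    (hF : ∀ a ∈ s, DifferentiableAt ℝ (F a) y) :
    pderiv i (fun z => ∑ a ∈ s, F a z) y = ∑ a ∈ s, pderiv i (F a) y := by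
  simp [pderiv, fderiv_fun_sum hF]

lemma contDiffOn_pderiv (hU : IsOpen U) (hf : ContDiffOn ℝ ∞ f U) (i : Fin n) :
    ContDiffOn ℝ ∞ (pderiv i f) U :=
  (hf.fderiv_of_isOpen hU (by simp)).clm_apply contDiffOn_const

lemma differentiableAt_of_contDiffOn (hU : IsOpen U) (hy : y ∈ U) (hf : ContDiffOn ℝ ∞ f U) :
    DifferentiableAt ℝ f y :=
  (hf.differentiableOn (by simp)).differentiableAt (hU.mem_nhds hy)

lemma pderiv_comm (hU : IsOpen U) (hy : y ∈ U) (hf : ContDiffOn ℝ ∞ f U) (i j : Fin n) :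
    pderiv i (pderiv j f) y = pderiv j (pderiv i f) y := by
  have hd : DifferentiableAt ℝ (fderiv ℝ f) y :=
    ((hf.fderiv_of_isOpen hU (m := ∞) (by simp)).differentiableOn (by simp)).differentiableAt
      (hU.mem_nhds hy)
  have hs : IsSymmSndFDerivAt ℝ f y :=
    (hf.contDiffAt (hU.mem_nhds hy)).isSymmSndFDerivAt
      (by simpa using (by exact_mod_cast le_top : ((2 : ℕ∞) : WithTop ℕ∞) ≤ ∞))
  have key : ∀ a b : Fin n, pderiv a (pderiv b f) y
      = fderiv ℝ (fderiv ℝ f) y (EuclideanSpace.single a 1) (EuclideanSpace.single b 1) := by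
    intro a b
    change fderiv ℝ (fun z => fderiv ℝ f z (EuclideanSpace.single b 1)) y _ = _
    rw [fderiv_clm_apply hd (differentiableAt_const _)]
    simp
  rw [key, key, hs.eq]

/-- The chain rule in coordinates. -/
lemma pderiv_comp (i : Fin n) {φ : EuclideanSpace ℝ (Fin n) → EuclideanSpace ℝ (Fin n)}
    (hf : DifferentiableAt ℝ f (φ y)) (hφ : DifferentiableAt ℝ φ y) :
    pderiv i (fun z => f (φ z)) y
      = ∑ a, pderiv i (fun z => φ z a) y * pderiv a f (φ y) := by
  have h1 : ∀ a, pderiv i (fun z => φ z a) y = (fderiv ℝ φ y (EuclideanSpace.single i 1)) a := by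
    intro a
    have := ((EuclideanSpace.proj (𝕜 := ℝ) a).hasFDerivAt (x := φ y)).comp y hφ.hasFDerivAt
    have h2 := this.fderiv
    change fderiv ℝ (fun z => φ z a) y _ = _
    change fderiv ℝ (fun z => φ z a) y = _ at h2
    rw [h2]; rfl
  have h3 : fderiv ℝ (fun z => f (φ z)) y = (fderiv ℝ f (φ y)).comp (fderiv ℝ φ y) :=
    fderiv_fun_comp y hf hφ
  rw [pderiv, h3, ContinuousLinearMap.comp_apply]
  set v := fderiv ℝ φ y (EuclideanSpace.single i 1) with hv
  have h4 : v = ∑ a, v a • EuclideanSpace.single a (1 : ℝ) := by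
    have := (EuclideanSpace.basisFun (Fin n) ℝ).sum_repr v
    simpa using this.symm
  conv_lhs => rw [h4]
  simp only [h1]
  simp [map_sum, pderiv]

end

/-! ### Metrics in coordinates and their Levi-Civita connection -/

section

/-- A smooth nondegenerate symmetric matrix field on the open set `U`, that is a
pseudo-Riemannian metric in coordinates; definiteness plays no role in the local formulas. -/
structure IsCoordMetric {n : ℕ} (U : Set (EuclideanSpace ℝ (Fin n)))
    (G : EuclideanSpace ℝ (Fin n) → Matrix (Fin n) (Fin n) ℝ) : Prop where
  isOpen : IsOpen U
  symm : ∀ y ∈ U, ∀ i j, G y i j = G y j i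
  smooth : ∀ i j, ContDiffOn ℝ ∞ (fun y => G y i j) U
  det_ne : ∀ y ∈ U, (G y).det ≠ 0

namespace IsCoordMetric

variable {n : ℕ} {U : Set (EuclideanSpace ℝ (Fin n))} {y : EuclideanSpace ℝ (Fin n)}
  {G : EuclideanSpace ℝ (Fin n) → Matrix (Fin n) (Fin n) ℝ}

lemma differentiableAt (h : IsCoordMetric U G) (hy : y ∈ U) (i j : Fin n) :
    DifferentiableAt ℝ (fun y => G y i j) y :=
  differentiableAt_of_contDiffOn h.isOpen hy (h.smooth i j)

lemma isUnit_det (h : IsCoordMetric U G) (hy : y ∈ U) : IsUnit (G y).det :=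
  (h.det_ne y hy).isUnit

lemma inv_mul_apply (h : IsCoordMetric U G) (hy : y ∈ U) (k j : Fin n) :
    ∑ l, (G y)⁻¹ k l * G y l j = if k = j then 1 else 0 := by
  rw [← Matrix.mul_apply, Matrix.nonsing_inv_mul _ (h.isUnit_det hy), Matrix.one_apply]

lemma inv_symm (h : IsCoordMetric U G) (hy : y ∈ U) (i j : Fin n) :
    (G y)⁻¹ i j = (G y)⁻¹ j i := by
  have hG : (G y).transpose = G y := by
    ext i j
    exact h.symm y hy j i
  have := congrFun (congrFun (Matrix.transpose_nonsing_inv (G y)) j) i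
  rw [hG] at this
  exact this

/-- Raising an index inverts lowering it. -/
lemma eq_raise (h : IsCoordMetric U G) (hy : y ∈ U) {X w : Fin n → ℝ}
    (hX : ∀ l, ∑ k, G y l k * X k = w l) (k : Fin n) : X k = ∑ l, (G y)⁻¹ k l * w l := by
  have h1 : (G y).mulVec X = w := funext hX
  have h2 : (G y)⁻¹.mulVec ((G y).mulVec X) = X := by
    rw [Matrix.mulVec_mulVec, Matrix.nonsing_inv_mul _ (h.isUnit_det hy), Matrix.one_mulVec]
  rw [h1] at h2
  exact (congrFun h2 k).symm

lemma lower_raise (h : IsCoordMetric U G) (hy : y ∈ U) (w : Fin n → ℝ) (l : Fin n) :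
    ∑ k, G y l k * ∑ m, (G y)⁻¹ k m * w m = w l := by
  have h2 : (G y).mulVec ((G y)⁻¹.mulVec w) = w := by
    rw [Matrix.mulVec_mulVec, Matrix.mul_nonsing_inv _ (h.isUnit_det hy), Matrix.one_mulVec]
  exact congrFun h2 l

lemma contDiffOn_det (h : IsCoordMetric U G) : ContDiffOn ℝ ∞ (fun y => (G y).det) U := by
  simp only [Matrix.det_apply']
  exact ContDiffOn.sum fun σ _ =>
    contDiffOn_const.mul (contDiffOn_prod fun i _ => h.smooth _ _)

lemma contDiffOn_inv (h : IsCoordMetric U G) (k l : Fin n) :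
    ContDiffOn ℝ ∞ (fun y => (G y)⁻¹ k l) U := by
  have h1 : ContDiffOn ℝ ∞ (fun y => (G y).adjugate k l) U := by
    simp only [Matrix.adjugate_apply, Matrix.det_apply']
    refine ContDiffOn.sum fun σ _ => contDiffOn_const.mul (contDiffOn_prod fun i _ => ?_)
    simp only [Matrix.updateRow_apply]
    split_ifs
    · exact contDiffOn_const
    · exact h.smooth _ _
  have h2 : (fun y => (G y)⁻¹ k l) = fun y => ((G y).det)⁻¹ * (G y).adjugate k l := by
    ext y
    simp [Matrix.inv_def]
  rw [h2]
  exact (h.contDiffOn_det.inv h.det_ne).mul h1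

lemma contDiffOn_christoffel (h : IsCoordMetric U G) (k i j : Fin n) :
    ContDiffOn ℝ ∞ (christoffel G k i j) U := by
  have hp : ∀ a b c, ContDiffOn ℝ ∞ (pderiv a (fun z => G z b c)) U := fun a b c =>
    contDiffOn_pderiv h.isOpen (h.smooth b c) a
  exact contDiffOn_const.mul (ContDiffOn.sum fun l _ =>
    (h.contDiffOn_inv k l).mul (((hp _ _ _).add (hp _ _ _)).sub (hp _ _ _)))

lemma differentiableAt_christoffel (h : IsCoordMetric U G) (hy : y ∈ U) (k i j : Fin n) :
    DifferentiableAt ℝ (christoffel G k i j) y :=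
  differentiableAt_of_contDiffOn h.isOpen hy (h.contDiffOn_christoffel k i j)

lemma contDiffOn_coordScalar (h : IsCoordMetric U G) : ContDiffOn ℝ ∞ (coordScalar G) U := by
  have hp : ∀ a b c d, ContDiffOn ℝ ∞ (pderiv a (christoffel G b c d)) U := fun a b c d =>
    contDiffOn_pderiv h.isOpen (h.contDiffOn_christoffel b c d) a
  have hc := h.contDiffOn_christoffel
  exact ContDiffOn.sum fun j _ => ContDiffOn.sum fun k _ => (h.contDiffOn_inv j k).mul
    (ContDiffOn.sum fun i _ => (((hp _ _ _ _).sub (hp _ _ _ _)).add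
      (ContDiffOn.sum fun m _ => ((hc _ _ _).mul (hc _ _ _)).sub ((hc _ _ _).mul (hc _ _ _)))))

lemma pderiv_symm (h : IsCoordMetric U G) (hy : y ∈ U) (l i j : Fin n) :
    pderiv l (fun z => G z i j) y = pderiv l (fun z => G z j i) y :=
  pderiv_congr_of_eqOn h.isOpen hy l fun z hz => h.symm z hz i j

lemma christoffel_symm (h : IsCoordMetric U G) (hy : y ∈ U) (k i j : Fin n) :
    christoffel G k i j y = christoffel G k j i y := by
  simp only [christoffel, h.pderiv_symm hy _ i j]
  congr 1
  exact Finset.sum_congr rfl fun l _ => by ring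

/-- The Christoffel symbols of the first kind. -/
lemma lower_christoffel (h : IsCoordMetric U G) (hy : y ∈ U) (l i j : Fin n) :
    ∑ k, G y l k * christoffel G k i j y
      = (1 / 2 : ℝ) * (pderiv i (fun z => G z j l) y + pderiv j (fun z => G z i l) y
      - pderiv l (fun z => G z i j) y) := by
  have := h.lower_raise hy (fun l => (1 / 2 : ℝ) * (pderiv i (fun z => G z j l) y
    + pderiv j (fun z => G z i l) y - pderiv l (fun z => G z i j) y)) l
  rw [← this]
  refine Finset.sum_congr rfl fun k _ => ?_
  rw [christoffel, Finset.mul_sum]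
  congr 1
  exact Finset.sum_congr rfl fun l _ => by ring

/-- The Christoffel symbols of the second kind are determined by those of the first kind. -/
lemma eq_christoffel (h : IsCoordMetric U G) (hy : y ∈ U) (i j : Fin n) {X : Fin n → ℝ}
    (hX : ∀ l, ∑ k, G y l k * X k
      = (1 / 2 : ℝ) * (pderiv i (fun z => G z j l) y + pderiv j (fun z => G z i l) y
      - pderiv l (fun z => G z i j) y)) (k : Fin n) :
    christoffel G k i j y = X k := by
  rw [h.eq_raise hy hX, christoffel, Finset.mul_sum]
  exact Finset.sum_congr rfl fun l _ => by ring

/-- The Levi-Civita connection is compatible with the metric. -/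
lemma pderiv_metric (h : IsCoordMetric U G) (hy : y ∈ U) (i j k : Fin n) :
    pderiv i (fun z => G z j k) y
      = ∑ m, G y k m * christoffel G m i j y + ∑ m, G y j m * christoffel G m i k y := by
  rw [h.lower_christoffel hy, h.lower_christoffel hy, h.pderiv_symm hy i k j]
  ring

end IsCoordMetric

end

/-! ### Conformal change of the scalar curvature -/

section

/-- The vector field `F^k = ∑_l G^{kl} w_l` obtained from the 1-form `w` by raising the index. -/
noncomputable def raise {n : ℕ} (G : EuclideanSpace ℝ (Fin n) → Matrix (Fin n) (Fin n) ℝ)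
    (w : Fin n → EuclideanSpace ℝ (Fin n) → ℝ) (k : Fin n) (y : EuclideanSpace ℝ (Fin n)) : ℝ :=
  ∑ l, (G y)⁻¹ k l * w l y

/-- The tensor `C^k_{ij} = δ^k_j w_i + δ^k_i w_j - G_{ij} w^k`. For `w = dφ / 2φ` it is the
difference of the Levi-Civita connections of `φ G` and of `G`. -/
noncomputable def confDiff {n : ℕ} (G : EuclideanSpace ℝ (Fin n) → Matrix (Fin n) (Fin n) ℝ)
    (w : Fin n → EuclideanSpace ℝ (Fin n) → ℝ) (k i j : Fin n)
    (y : EuclideanSpace ℝ (Fin n)) : ℝ :=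
  (if k = j then 1 else 0) * w i y + (if k = i then 1 else 0) * w j y - G y i j * raise G w k y

/-- The covariant derivative `(∇_i w)_l = ∂_i w_l - ∑_m Γ^m_{il} w_m` of the 1-form `w`. -/
noncomputable def covDeriv {n : ℕ} (G : EuclideanSpace ℝ (Fin n) → Matrix (Fin n) (Fin n) ℝ)
    (w : Fin n → EuclideanSpace ℝ (Fin n) → ℝ) (i l : Fin n)
    (y : EuclideanSpace ℝ (Fin n)) : ℝ :=
  pderiv i (w l) y - ∑ m, christoffel G m i l y * w m y

namespace IsCoordMetric

variable {n : ℕ} {U : Set (EuclideanSpace ℝ (Fin n))} {y : EuclideanSpace ℝ (Fin n)}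
  {G : EuclideanSpace ℝ (Fin n) → Matrix (Fin n) (Fin n) ℝ}
  {w : Fin n → EuclideanSpace ℝ (Fin n) → ℝ} {φ : EuclideanSpace ℝ (Fin n) → ℝ}

lemma contDiffOn_raise (h : IsCoordMetric U G) (hw : ∀ i, ContDiffOn ℝ ∞ (w i) U) (k : Fin n) :
    ContDiffOn ℝ ∞ (raise G w k) U :=
  ContDiffOn.sum fun l _ => (h.contDiffOn_inv k l).mul (hw l)

lemma differentiableAt_raise (h : IsCoordMetric U G) (hw : ∀ i, ContDiffOn ℝ ∞ (w i) U) (hy : y ∈ U)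
    (k : Fin n) : DifferentiableAt ℝ (raise G w k) y :=
  differentiableAt_of_contDiffOn h.isOpen hy (h.contDiffOn_raise hw k)

lemma sum_metric_mul_raise (h : IsCoordMetric U G) (hy : y ∈ U) (l : Fin n) :
    ∑ k, G y l k * raise G w k y = w l y :=
  h.lower_raise hy (fun l => w l y) l

lemma contDiffOn_confDiff (h : IsCoordMetric U G) (hw : ∀ i, ContDiffOn ℝ ∞ (w i) U)
    (k i j : Fin n) : ContDiffOn ℝ ∞ (confDiff G w k i j) U :=
  ((contDiffOn_const.mul (hw i)).add (contDiffOn_const.mul (hw j))).sub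
    ((h.smooth i j).mul (h.contDiffOn_raise hw k))

lemma confDiff_symm (h : IsCoordMetric U G) (hy : y ∈ U) (k i j : Fin n) :
    confDiff G w k i j y = confDiff G w k j i y := by
  simp only [confDiff, h.symm y hy i j]
  ring

lemma sum_mul_confDiff_upper (a : Fin n → ℝ) (i j : Fin n) :
    ∑ m, a m * confDiff G w m i j y
      = a j * w i y + a i * w j y - G y i j * ∑ m, a m * raise G w m y := by
  simp only [confDiff, mul_sub, mul_add, Finset.sum_sub_distrib, Finset.sum_add_distrib]
  simp only [ite_mul, mul_ite, one_mul, zero_mul, mul_zero, Finset.sum_ite_eq',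
    Finset.mem_univ, if_true]
  rw [Finset.mul_sum]
  congr 1
  exact Finset.sum_congr rfl fun m _ => by ring

lemma sum_mul_confDiff_lower (a : Fin n → ℝ) (k j : Fin n) :
    ∑ m, a m * confDiff G w k m j y
      = (if k = j then 1 else 0) * (∑ m, a m * w m y) + a k * w j y
        - raise G w k y * ∑ m, a m * G y m j := by
  simp only [confDiff, mul_sub, mul_add, Finset.sum_sub_distrib, Finset.sum_add_distrib]
  simp only [Finset.mul_sum]
  congr 1
  · congr 1
    · exact Finset.sum_congr rfl fun m _ => by ring
    · simp [ite_mul, mul_ite]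
  · exact Finset.sum_congr rfl fun m _ => by ring

/-- Covariant differentiation commutes with raising an index. -/
lemma covDeriv_eq_lower (h : IsCoordMetric U G) (hw : ∀ i, ContDiffOn ℝ ∞ (w i) U) (hy : y ∈ U)
    (i l : Fin n) :
    ∑ k, G y l k * (pderiv i (raise G w k) y + ∑ m, christoffel G k i m y * raise G w m y)
      = covDeriv G w i l y := by
  -- differentiating `w_l = ∑ G_{lk} w^k` avoids the derivative of the inverse matrix
  have h1 : pderiv i (w l) y = pderiv i (fun z => ∑ k, G z l k * raise G w k z) y :=
    pderiv_congr_of_eqOn h.isOpen hy i fun z hz => (h.sum_metric_mul_raise hz l).symm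
  rw [pderiv_sum _ _ fun k _ =>
    (h.differentiableAt hy l k).fun_mul (h.differentiableAt_raise hw hy k)] at h1
  have h2 : ∀ k, pderiv i (fun z => G z l k * raise G w k z) y
      = (∑ m, G y k m * christoffel G m i l y) * raise G w k y
        + (∑ m, G y l m * christoffel G m i k y) * raise G w k y
        + G y l k * pderiv i (raise G w k) y := by
    intro k
    rw [pderiv_mul i (h.differentiableAt hy l k) (h.differentiableAt_raise hw hy k),
      h.pderiv_metric hy i l k]
    ring
  simp only [h2, Finset.sum_add_distrib] at h1
  have h3 : ∑ k, (∑ m, G y k m * christoffel G m i l y) * raise G w k y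
      = ∑ m, christoffel G m i l y * w m y := by
    simp only [← h.sum_metric_mul_raise (w := w) hy, Finset.mul_sum, Finset.sum_mul]
    rw [Finset.sum_comm]
    exact Finset.sum_congr rfl fun m _ => Finset.sum_congr rfl fun k _ => by
      rw [h.symm y hy k m]; ring
  have h4 : ∑ k, (∑ m, G y l m * christoffel G m i k y) * raise G w k y
      = ∑ k, G y l k * ∑ m, christoffel G k i m y * raise G w m y := by
    simp only [Finset.mul_sum, Finset.sum_mul]
    rw [Finset.sum_comm]
    exact Finset.sum_congr rfl fun m _ => Finset.sum_congr rfl fun k _ => by ring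
  rw [h3, h4] at h1
  rw [covDeriv, h1]
  simp only [mul_add, Finset.sum_add_distrib]
  ring

lemma raise_covDeriv (h : IsCoordMetric U G) (hw : ∀ i, ContDiffOn ℝ ∞ (w i) U) (hy : y ∈ U)
    (i k : Fin n) :
    pderiv i (raise G w k) y + ∑ m, christoffel G k i m y * raise G w m y
      = ∑ l, (G y)⁻¹ k l * covDeriv G w i l y :=
  h.eq_raise hy (fun l => h.covDeriv_eq_lower hw hy i l) k

/-- The covariant derivative of `C` is `C` with `w` replaced by `∇_i w`, since `∇G = 0`. -/
lemma covDeriv_confDiff (h : IsCoordMetric U G) (hw : ∀ i, ContDiffOn ℝ ∞ (w i) U) (hy : y ∈ U)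
    (i k j l : Fin n) :
    pderiv i (confDiff G w k j l) y + ∑ m, christoffel G k i m y * confDiff G w m j l y
        - ∑ m, christoffel G m i j y * confDiff G w k m l y
        - ∑ m, christoffel G m i l y * confDiff G w k m j y
      = (if k = l then 1 else 0) * covDeriv G w i j y
        + (if k = j then 1 else 0) * covDeriv G w i l y
        - G y j l * ∑ m, (G y)⁻¹ k m * covDeriv G w i m y := by
  have hd : ∀ i, DifferentiableAt ℝ (w i) y := fun i =>
    differentiableAt_of_contDiffOn h.isOpen hy (hw i)
  have h1 : pderiv i (confDiff G w k j l) y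
      = (if k = l then 1 else 0) * pderiv i (w j) y + (if k = j then 1 else 0) * pderiv i (w l) y
        - (pderiv i (fun z => G z j l) y * raise G w k y
          + G y j l * pderiv i (raise G w k) y) := by
    rw [← pderiv_mul i (h.differentiableAt hy j l) (h.differentiableAt_raise hw hy k),
      ← pderiv_const_mul i _ (hd j),
      ← pderiv_const_mul i _ (hd l),
      ← pderiv_add i ((hd j).const_mul _) ((hd l).const_mul _)]
    exact pderiv_sub i (((hd j).const_mul _).add ((hd l).const_mul _))
      ((h.differentiableAt hy j l).mul (h.differentiableAt_raise hw hy k))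
  rw [h1, sum_mul_confDiff_upper, sum_mul_confDiff_lower, sum_mul_confDiff_lower,
    h.pderiv_metric hy, ← h.raise_covDeriv hw hy i k, covDeriv, covDeriv]
  have e1 : ∑ m, christoffel G m i j y * G y m l = ∑ m, G y l m * christoffel G m i j y :=
    Finset.sum_congr rfl fun m _ => by rw [h.symm y hy m l]; ring
  have e2 : ∑ m, christoffel G m i l y * G y m j = ∑ m, G y j m * christoffel G m i l y :=
    Finset.sum_congr rfl fun m _ => by rw [h.symm y hy m j]; ring
  rw [e1, e2]
  ring

lemma conformal (h : IsCoordMetric U G) (hφ : ContDiffOn ℝ ∞ φ U) (hφ0 : ∀ y ∈ U, φ y ≠ 0) :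
    IsCoordMetric U (fun y => φ y • G y) where
  isOpen := h.isOpen
  symm y hy i j := by simp [h.symm y hy i j]
  smooth i j := hφ.mul (h.smooth i j)
  det_ne y hy := by
    rw [Matrix.det_smul]
    exact mul_ne_zero (pow_ne_zero _ (hφ0 y hy)) (h.det_ne y hy)

lemma christoffel_conformal (h : IsCoordMetric U G) (hφ : ContDiffOn ℝ ∞ φ U)
    (hφ0 : ∀ y ∈ U, φ y ≠ 0) (hφw : ∀ y ∈ U, ∀ i, pderiv i φ y = 2 * φ y * w i y) (hy : y ∈ U)
    (k i j : Fin n) :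
    christoffel (fun y => φ y • G y) k i j y
      = christoffel G k i j y + confDiff G w k i j y := by
  refine (h.conformal hφ hφ0).eq_christoffel hy i j
    (X := fun k => christoffel G k i j y + confDiff G w k i j y) (fun l => ?_) k
  have hp : ∀ a b c, pderiv a (fun z => (φ z • G z) b c) y
      = 2 * φ y * w a y * G y b c + φ y * pderiv a (fun z => G z b c) y := by
    intro a b c
    rw [← hφw y hy]
    exact pderiv_mul a (differentiableAt_of_contDiffOn h.isOpen hy hφ) (h.differentiableAt hy b c)
  simp only [hp]
  simp only [Matrix.smul_apply, smul_eq_mul, mul_add, Finset.sum_add_distrib, mul_assoc,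
    ← Finset.mul_sum]
  rw [h.lower_christoffel hy, sum_mul_confDiff_upper, h.sum_metric_mul_raise hy, h.symm y hy j l,
    h.symm y hy i l]
  ring

/-- `R' = R + ∇_i C_j - ∇_j C_i + [C_i, C_j]` for the connection `Γ' = Γ + C`, with the covariant
derivatives of `C` written out. -/
lemma riemann_conformal (h : IsCoordMetric U G) (hφ : ContDiffOn ℝ ∞ φ U)
    (hφ0 : ∀ y ∈ U, φ y ≠ 0) (hw : ∀ i, ContDiffOn ℝ ∞ (w i) U)
    (hφw : ∀ y ∈ U, ∀ i, pderiv i φ y = 2 * φ y * w i y) (hy : y ∈ U)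
    (l i j k : Fin n) :
    riemann (fun y => φ y • G y) l i j k y
      = riemann G l i j k y
        + ((if l = k then 1 else 0) * covDeriv G w i j y
          + (if l = j then 1 else 0) * covDeriv G w i k y
          - G y j k * ∑ m, (G y)⁻¹ l m * covDeriv G w i m y)
        - ((if l = k then 1 else 0) * covDeriv G w j i y
          + (if l = i then 1 else 0) * covDeriv G w j k y
          - G y i k * ∑ m, (G y)⁻¹ l m * covDeriv G w j m y)
        + (∑ m, confDiff G w l i m y * confDiff G w m j k y
          - ∑ m, confDiff G w l j m y * confDiff G w m i k y) := by
  have hC : ∀ a b c, DifferentiableAt ℝ (confDiff G w a b c) y := fun a b c =>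
    differentiableAt_of_contDiffOn h.isOpen hy (h.contDiffOn_confDiff hw a b c)
  have hp : ∀ a b c d, pderiv a (christoffel (fun y => φ y • G y) b c d) y
      = pderiv a (christoffel G b c d) y + pderiv a (confDiff G w b c d) y := by
    intro a b c d
    rw [← pderiv_add a (h.differentiableAt_christoffel hy b c d) (hC b c d)]
    exact pderiv_congr_of_eqOn h.isOpen hy a fun z hz =>
      h.christoffel_conformal hφ hφ0 hφw hz b c d
  rw [← h.covDeriv_confDiff hw hy i l j k, ← h.covDeriv_confDiff hw hy j l i k]
  simp only [riemann, hp, h.christoffel_conformal hφ hφ0 hφw hy, add_mul, mul_add,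
    Finset.sum_add_distrib, Finset.sum_sub_distrib]
  have e1 : ∑ m, christoffel G m j i y * confDiff G w l m k y
      = ∑ m, christoffel G m i j y * confDiff G w l m k y :=
    Finset.sum_congr rfl fun m _ => by rw [h.christoffel_symm hy]
  have e2 : ∀ i j, ∑ m, christoffel G m i k y * confDiff G w l m j y
      = ∑ m, confDiff G w l j m y * christoffel G m i k y := fun i j =>
    Finset.sum_congr rfl fun m _ => by rw [h.confDiff_symm hy, mul_comm]
  rw [e1, e2 i j, e2 j i]
  ring

/-- The antisymmetric part of `∇w` is kept, so that `w` need not be known to be closed; it drops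
out of the full trace. -/
lemma ricci_conformal (h : IsCoordMetric U G) (hφ : ContDiffOn ℝ ∞ φ U)
    (hφ0 : ∀ y ∈ U, φ y ≠ 0) (hw : ∀ i, ContDiffOn ℝ ∞ (w i) U)
    (hφw : ∀ y ∈ U, ∀ i, pderiv i φ y = 2 * φ y * w i y) (hy : y ∈ U)
    (j k : Fin n) :
    ricci (fun y => φ y • G y) j k y
      = ricci G j k y + (1 - (n : ℝ)) * covDeriv G w j k y + covDeriv G w k j y
        - (∑ i, ∑ m, (G y)⁻¹ i m * covDeriv G w i m y) * G y j k
        + ((n : ℝ) - 2) * (w j y * w k y - G y j k * ∑ i, w i y * raise G w i y) := by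
  have h1 : ∑ i, G y i k * ∑ m, (G y)⁻¹ i m * covDeriv G w j m y = covDeriv G w j k y := by
    rw [← h.lower_raise hy (fun m => covDeriv G w j m y) k]
    exact Finset.sum_congr rfl fun i _ => by rw [h.symm y hy i k]
  -- the trace of `C` is `n w`
  have htr : ∀ m, ∑ i, confDiff G w i i m y = (n : ℝ) * w m y := by
    intro m
    simp only [confDiff, Finset.sum_sub_distrib, Finset.sum_add_distrib, ite_mul, one_mul,
      zero_mul, Finset.sum_ite_eq', Finset.mem_univ, if_true, Finset.sum_const,
      Finset.card_univ, Fintype.card_fin, nsmul_eq_mul]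
    have := h.sum_metric_mul_raise (w := w) hy m
    simp only [h.symm y hy m] at this
    rw [this]
    ring
  have h2 : ∑ i, ∑ m, confDiff G w i i m y * confDiff G w m j k y
      = (n : ℝ) * (2 * (w j y * w k y) - G y j k * ∑ i, w i y * raise G w i y) := by
    rw [Finset.sum_comm]
    simp only [← Finset.sum_mul, htr, mul_assoc, ← Finset.mul_sum]
    rw [sum_mul_confDiff_upper]
    ring
  have h3 : ∑ i, ∑ m, confDiff G w i j m y * confDiff G w m i k y
      = ((n : ℝ) + 2) * (w j y * w k y) - 2 * (G y j k * ∑ i, w i y * raise G w i y) := by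
    have hl : ∀ l, ∑ i, G y i l * raise G w i y = w l y := fun l => by
      rw [← h.sum_metric_mul_raise (w := w) hy l]
      exact Finset.sum_congr rfl fun i _ => by rw [h.symm y hy i l]
    simp only [sum_mul_confDiff_upper]
    simp only [Finset.sum_sub_distrib, Finset.sum_add_distrib]
    have a1 : ∑ i, confDiff G w i j k y * w i y
        = 2 * (w j y * w k y) - G y j k * ∑ i, w i y * raise G w i y := by
      have := sum_mul_confDiff_upper (G := G) (w := w) (y := y) (fun i => w i y) j k
      simp only [mul_comm (confDiff G w _ j k y)]
      rw [this]
      ring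
    have a2 : ∑ i, confDiff G w i j i y * w k y = (n : ℝ) * w j y * w k y := by
      rw [← Finset.sum_mul, ← htr j]
      congr 1
      exact Finset.sum_congr rfl fun i _ => h.confDiff_symm hy _ _ _
    have a3 : ∀ i, ∑ m, confDiff G w i j m y * raise G w m y
        = (if i = j then 1 else 0) * ∑ m, w m y * raise G w m y := by
      intro i
      have := sum_mul_confDiff_lower (G := G) (w := w) (y := y) (fun m => raise G w m y) i j
      have e : ∑ m, confDiff G w i j m y * raise G w m y
          = ∑ m, raise G w m y * confDiff G w i m j y :=
        Finset.sum_congr rfl fun m _ => by rw [h.confDiff_symm hy, mul_comm]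
      rw [e, this]
      have e2 : ∑ m, raise G w m y * G y m j = w j y := by
        rw [← hl j]
        exact Finset.sum_congr rfl fun m _ => mul_comm _ _
      rw [e2]
      simp only [mul_comm (raise G w _ y) (w _ y)]
      ring
    have a4 : ∑ i, G y i k * ((if i = j then 1 else 0) * ∑ m, w m y * raise G w m y)
        = G y j k * ∑ m, w m y * raise G w m y := by
      simp
    simp only [a3]
    rw [a1, a2, a4]
    ring
  simp only [ricci, h.riemann_conformal hφ hφ0 hw hφw hy, Finset.sum_add_distrib,
    Finset.sum_sub_distrib, h1, h2, h3, ← Finset.mul_sum]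
  simp only [ite_mul, one_mul, zero_mul, Finset.sum_ite_eq', Finset.mem_univ, if_true,
    Finset.sum_const, Finset.card_univ, Fintype.card_fin, nsmul_eq_mul]
  ring

/-- The scalar curvature of the conformal metric `φ G`, where `w = dφ / 2φ = d(log φ) / 2`. -/
lemma coordScalar_conformal (h : IsCoordMetric U G) (hφ : ContDiffOn ℝ ∞ φ U)
    (hφ0 : ∀ y ∈ U, φ y ≠ 0) (hw : ∀ i, ContDiffOn ℝ ∞ (w i) U)
    (hφw : ∀ y ∈ U, ∀ i, pderiv i φ y = 2 * φ y * w i y) (hy : y ∈ U) :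
    coordScalar (fun y => φ y • G y) y
      = (φ y)⁻¹ * (coordScalar G y
        - 2 * ((n : ℝ) - 1) * ∑ i, ∑ j, (G y)⁻¹ i j * covDeriv G w i j y
        - ((n : ℝ) - 1) * ((n : ℝ) - 2) * ∑ i, ∑ j, (G y)⁻¹ i j * (w i y * w j y)) := by
  have hinv : ∀ j k, (φ y • G y)⁻¹ j k = (φ y)⁻¹ * (G y)⁻¹ j k := by
    intro j k
    have : (φ y • G y)⁻¹ = (φ y)⁻¹ • (G y)⁻¹ := by
      have := invertibleOfNonzero (hφ0 y hy)
      rw [Matrix.inv_smul (G y) (φ y) (h.isUnit_det hy), invOf_eq_inv]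
    rw [this, Matrix.smul_apply, smul_eq_mul]
  have hww : ∑ i, w i y * raise G w i y = ∑ i, ∑ j, (G y)⁻¹ i j * (w i y * w j y) := by
    refine Finset.sum_congr rfl fun i _ => ?_
    rw [raise, Finset.mul_sum]
    exact Finset.sum_congr rfl fun j _ => by ring
  have htr : ∑ j, ∑ k, (G y)⁻¹ j k * G y j k = (n : ℝ) := by
    have : ∀ j, ∑ k, (G y)⁻¹ j k * G y j k = 1 := by
      intro j
      have := h.inv_mul_apply hy j j
      rw [if_pos rfl] at this
      rw [← this]
      exact Finset.sum_congr rfl fun k _ => by rw [h.symm y hy j k]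
    simp [this]
  have hT : ∑ j, ∑ k, (G y)⁻¹ j k * covDeriv G w k j y
      = ∑ j, ∑ k, (G y)⁻¹ j k * covDeriv G w j k y := by
    rw [Finset.sum_comm]
    exact Finset.sum_congr rfl fun i _ => Finset.sum_congr rfl fun j _ => by
      rw [h.inv_symm hy]
  simp only [coordScalar, hinv, h.ricci_conformal hφ hφ0 hw hφw hy, hww]
  set T := ∑ i, ∑ j, (G y)⁻¹ i j * covDeriv G w i j y with hTdef
  set N := ∑ i, ∑ j, (G y)⁻¹ i j * (w i y * w j y) with hN
  have expand : ∀ j k, (φ y)⁻¹ * (G y)⁻¹ j k * (ricci G j k y + (1 - (n : ℝ)) * covDeriv G w j k y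
        + covDeriv G w k j y - T * G y j k
        + ((n : ℝ) - 2) * (w j y * w k y - G y j k * N))
      = (φ y)⁻¹ * ((G y)⁻¹ j k * ricci G j k y
        + (1 - (n : ℝ)) * ((G y)⁻¹ j k * covDeriv G w j k y)
        + (G y)⁻¹ j k * covDeriv G w k j y - T * ((G y)⁻¹ j k * G y j k)
        + ((n : ℝ) - 2) * ((G y)⁻¹ j k * (w j y * w k y))
        - ((n : ℝ) - 2) * N * ((G y)⁻¹ j k * G y j k)) := fun j k => by ring
  simp only [expand, ← Finset.mul_sum, Finset.sum_add_distrib, Finset.sum_sub_distrib, htr, hT,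
    ← hTdef, ← hN]
  ring

end IsCoordMetric

end

section

namespace IsCoordMetric

variable {n : ℕ} {U : Set (EuclideanSpace ℝ (Fin n))} {y : EuclideanSpace ℝ (Fin n)}
  {G : EuclideanSpace ℝ (Fin n) → Matrix (Fin n) (Fin n) ℝ}
  {u : EuclideanSpace ℝ (Fin n) → ℝ}

/-- The Yamabe equation in coordinates: the exponent `p - 2` is the one for which the terms
quadratic in `du` cancel. -/
lemma coordScalar_yamabe (h : IsCoordMetric U G) (hn : 3 ≤ n) (hu : ContDiffOn ℝ ∞ u U)
    (hpos : ∀ y ∈ U, 0 < u y) (hy : y ∈ U) :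
    coordScalar (fun y => (u y ^ (yamabeP n - 2)) • G y) y * u y ^ (yamabeP n - 1)
      = -yamabeA n * coordLaplacian G u y + coordScalar G y * u y := by
  have hn3 : (3 : ℝ) ≤ n := by exact_mod_cast hn
  have hn2 : (n : ℝ) - 2 ≠ 0 := by linarith
  obtain ⟨c, hc⟩ : ∃ c : ℝ, c = 2 / ((n : ℝ) - 2) := ⟨_, rfl⟩
  have hp2 : yamabeP n - 2 = 2 * c := by
    rw [yamabeP, hc]
    field_simp
    ring
  have hc2 : c * ((n : ℝ) - 2) = 2 := by
    rw [hc]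
    field_simp
  have hA : yamabeA n = 2 * ((n : ℝ) - 1) * c := by
    rw [yamabeA, hc]
    field_simp
    ring
  have hud : ∀ y ∈ U, DifferentiableAt ℝ u y := fun y hy =>
    differentiableAt_of_contDiffOn h.isOpen hy hu
  have hφ : ContDiffOn ℝ ∞ (fun y => u y ^ (yamabeP n - 2)) U :=
    hu.rpow_const_of_ne fun y hy => (hpos y hy).ne'
  have hw : ∀ i, ContDiffOn ℝ ∞ (fun y => c * (pderiv i u y * (u y)⁻¹)) U := fun i =>
    contDiffOn_const.mul ((contDiffOn_pderiv h.isOpen hu i).mul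
      (hu.inv fun y hy => (hpos y hy).ne'))
  have hφw : ∀ y ∈ U, ∀ i, pderiv i (fun y => u y ^ (yamabeP n - 2)) y
      = 2 * u y ^ (yamabeP n - 2) * (c * (pderiv i u y * (u y)⁻¹)) := by
    intro y hy i
    have h1 := ((hud y hy).hasFDerivAt.rpow_const (p := yamabeP n - 2)
      (Or.inl (hpos y hy).ne')).fderiv
    rw [pderiv, h1, hp2, Real.rpow_sub_one (hpos y hy).ne']
    simp only [_root_.smul_apply, smul_eq_mul, pderiv]
    ring
  have hcov : ∀ i j, covDeriv G (fun i y => c * (pderiv i u y * (u y)⁻¹)) i j y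
      = c * (u y)⁻¹ * (pderiv i (pderiv j u) y - ∑ k, christoffel G k i j y * pderiv k u y)
        - c * (u y)⁻¹ ^ 2 * (pderiv i u y * pderiv j u y) := by
    intro i j
    have hinv : pderiv i (fun y => (u y)⁻¹) y = -(u y)⁻¹ ^ 2 * pderiv i u y := by
      have h1 := ((hasDerivAt_inv (hpos y hy).ne').comp_hasFDerivAt y (hud y hy).hasFDerivAt).fderiv
      change fderiv ℝ (fun y => (u y)⁻¹) y _ = _
      change fderiv ℝ (fun y => (u y)⁻¹) y = _ at h1
      rw [h1]
      simp [pderiv]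
    have hd1 : DifferentiableAt ℝ (pderiv j u) y :=
      differentiableAt_of_contDiffOn h.isOpen hy (contDiffOn_pderiv h.isOpen hu j)
    have hd2 : DifferentiableAt ℝ (fun y => (u y)⁻¹) y := (hud y hy).fun_inv (hpos y hy).ne'
    rw [covDeriv, pderiv_const_mul i c (hd1.fun_mul hd2), pderiv_mul i hd1 hd2, hinv]
    have : ∑ m, christoffel G m i j y * (c * (pderiv m u y * (u y)⁻¹))
        = c * (u y)⁻¹ * ∑ m, christoffel G m i j y * pderiv m u y := by
      rw [Finset.mul_sum]
      exact Finset.sum_congr rfl fun m _ => by ring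
    rw [this]
    ring
  have hu0 := (hpos y hy).ne'
  have hpow : u y ^ (yamabeP n - 1) = u y ^ (yamabeP n - 2) * u y := by
    rw [← Real.rpow_add_one hu0]
    congr 1
    ring
  have hpow0 : u y ^ (yamabeP n - 2) ≠ 0 := (Real.rpow_pos_of_pos (hpos y hy) _).ne'
  rw [h.coordScalar_conformal (w := fun i y => c * (pderiv i u y * (u y)⁻¹)) hφ
    (fun y hy => (Real.rpow_pos_of_pos (hpos y hy) _).ne') hw hφw hy]
  set N := ∑ i, ∑ j, (G y)⁻¹ i j * (pderiv i u y * pderiv j u y) with hN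
  have e1 : ∑ i, ∑ j, (G y)⁻¹ i j * covDeriv G (fun i y => c * (pderiv i u y * (u y)⁻¹)) i j y
      = c * (u y)⁻¹ * coordLaplacian G u y - c * (u y)⁻¹ ^ 2 * N := by
    simp only [hcov, coordLaplacian, hN, Finset.mul_sum, ← Finset.sum_sub_distrib]
    refine Finset.sum_congr rfl fun i _ => Finset.sum_congr rfl fun j _ => ?_
    ring
  have e2 : ∑ i, ∑ j, (G y)⁻¹ i j
        * ((c * (pderiv i u y * (u y)⁻¹)) * (c * (pderiv j u y * (u y)⁻¹)))
      = c ^ 2 * (u y)⁻¹ ^ 2 * N := by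
    simp only [hN, Finset.mul_sum]
    refine Finset.sum_congr rfl fun i _ => Finset.sum_congr rfl fun j _ => ?_
    ring
  have e3 : ((n : ℝ) - 1) * ((n : ℝ) - 2) * (c ^ 2 * (u y)⁻¹ ^ 2 * N)
      = 2 * ((n : ℝ) - 1) * (c * (u y)⁻¹ ^ 2 * N) := by
    linear_combination ((n : ℝ) - 1) * (c * (u y)⁻¹ ^ 2 * N) * hc2
  rw [e1, e2, e3, hA, hpow]
  field_simp
  ring

end IsCoordMetric

end

/-! ### Invariance of the scalar curvature under changes of coordinates -/

section

/-- The entrywise partial derivative of a matrix field. -/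
noncomputable def matDeriv {n : ℕ} (i : Fin n)
    (A : EuclideanSpace ℝ (Fin n) → Matrix (Fin n) (Fin n) ℝ) (y : EuclideanSpace ℝ (Fin n)) :
    Matrix (Fin n) (Fin n) ℝ :=
  Matrix.of fun a b => pderiv i (fun z => A z a b) y

/-- The connection matrix `(Γ_i)^k_j = Γ^k_{ij}`. -/
noncomputable def connMat {n : ℕ} (G : EuclideanSpace ℝ (Fin n) → Matrix (Fin n) (Fin n) ℝ)
    (i : Fin n) (y : EuclideanSpace ℝ (Fin n)) : Matrix (Fin n) (Fin n) ℝ :=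
  Matrix.of fun k j => christoffel G k i j y

/-- The curvature matrix `(R_{ij})^l_k = R^l_{ijk}`. -/
noncomputable def curvMat {n : ℕ} (G : EuclideanSpace ℝ (Fin n) → Matrix (Fin n) (Fin n) ℝ)
    (i j : Fin n) (y : EuclideanSpace ℝ (Fin n)) : Matrix (Fin n) (Fin n) ℝ :=
  Matrix.of fun l k => riemann G l i j k y

/-- The Jacobian matrix `J^a_i = ∂_i φ^a`. -/
noncomputable def jacobian {n : ℕ} (φ : EuclideanSpace ℝ (Fin n) → EuclideanSpace ℝ (Fin n))
    (y : EuclideanSpace ℝ (Fin n)) : Matrix (Fin n) (Fin n) ℝ :=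
  Matrix.of fun a i => pderiv i (fun z => φ z a) y

/-- The pullback `Jᵀ (G ∘ φ) J` of the metric `G` under `φ`. -/
noncomputable def pullback {n : ℕ} (φ : EuclideanSpace ℝ (Fin n) → EuclideanSpace ℝ (Fin n))
    (G : EuclideanSpace ℝ (Fin n) → Matrix (Fin n) (Fin n) ℝ) (y : EuclideanSpace ℝ (Fin n)) :
    Matrix (Fin n) (Fin n) ℝ :=
  (jacobian φ y).transpose * G (φ y) * jacobian φ y

variable {n : ℕ} {U V : Set (EuclideanSpace ℝ (Fin n))} {y : EuclideanSpace ℝ (Fin n)}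
  {G : EuclideanSpace ℝ (Fin n) → Matrix (Fin n) (Fin n) ℝ}
  {φ : EuclideanSpace ℝ (Fin n) → EuclideanSpace ℝ (Fin n)}

lemma matDeriv_mul {A B : EuclideanSpace ℝ (Fin n) → Matrix (Fin n) (Fin n) ℝ}
    (hA : ∀ a b, DifferentiableAt ℝ (fun z => A z a b) y)
    (hB : ∀ a b, DifferentiableAt ℝ (fun z => B z a b) y) (i : Fin n) :
    matDeriv i (fun z => A z * B z) y = matDeriv i A y * B y + A y * matDeriv i B y := by
  ext a b
  simp only [matDeriv, Matrix.of_apply, Matrix.mul_apply, Matrix.add_apply]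
  rw [pderiv_sum _ _ fun c _ => (hA a c).fun_mul (hB c b), ← Finset.sum_add_distrib]
  exact Finset.sum_congr rfl fun c _ => pderiv_mul i (hA a c) (hB c b)

lemma matDeriv_add {A B : EuclideanSpace ℝ (Fin n) → Matrix (Fin n) (Fin n) ℝ}
    (hA : ∀ a b, DifferentiableAt ℝ (fun z => A z a b) y)
    (hB : ∀ a b, DifferentiableAt ℝ (fun z => B z a b) y) (i : Fin n) :
    matDeriv i (fun z => A z + B z) y = matDeriv i A y + matDeriv i B y := by
  ext a b
  exact pderiv_add i (hA a b) (hB a b)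

lemma matDeriv_congr {A B : EuclideanSpace ℝ (Fin n) → Matrix (Fin n) (Fin n) ℝ}
    (hU : IsOpen U) (hy : y ∈ U) (i : Fin n) (h : ∀ z ∈ U, A z = B z) :
    matDeriv i A y = matDeriv i B y := by
  ext a b
  exact pderiv_congr_of_eqOn hU hy i fun z hz => by rw [h z hz]

/-- The structure equation `R_{ij} = ∂_i Γ_j - ∂_j Γ_i + [Γ_i, Γ_j]`. -/
lemma curvMat_eq (i j : Fin n) :
    curvMat G i j y = matDeriv i (connMat G j) y - matDeriv j (connMat G i) y
      + (connMat G i y * connMat G j y - connMat G j y * connMat G i y) := by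
  ext l k
  simp [curvMat, riemann, matDeriv, connMat, Matrix.mul_apply, Finset.sum_sub_distrib]

lemma contDiffOn_coord (hφ : ContDiffOn ℝ ∞ φ V) (a : Fin n) :
    ContDiffOn ℝ ∞ (fun z => φ z a) V :=
  (EuclideanSpace.proj (𝕜 := ℝ) a).contDiff.comp_contDiffOn hφ

lemma contDiffOn_jacobian (hV : IsOpen V) (hφ : ContDiffOn ℝ ∞ φ V) (a i : Fin n) :
    ContDiffOn ℝ ∞ (fun z => jacobian φ z a i) V :=
  contDiffOn_pderiv hV (contDiffOn_coord hφ a) i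

/-- Symmetry of the second derivatives of `φ`. -/
lemma matDeriv_jacobian_comm (hV : IsOpen V) (hφ : ContDiffOn ℝ ∞ φ V) (hy : y ∈ V)
    (a i j : Fin n) :
    matDeriv i (jacobian φ) y a j = matDeriv j (jacobian φ) y a i :=
  pderiv_comm hV hy (contDiffOn_coord hφ a) i j

lemma transpose_mul_mul_apply (A M B : Matrix (Fin n) (Fin n) ℝ) (j l : Fin n) :
    (A.transpose * M * B) j l = ∑ a, ∑ b, A a j * M a b * B b l := by
  simp only [Matrix.mul_apply, Matrix.transpose_apply, Finset.sum_mul]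
  exact Finset.sum_comm

lemma matDeriv_comp (hV : IsOpen V) (hy : y ∈ V) (hφ : ContDiffOn ℝ ∞ φ V)
    {A : EuclideanSpace ℝ (Fin n) → Matrix (Fin n) (Fin n) ℝ}
    (hA : ∀ a b, DifferentiableAt ℝ (fun z => A z a b) (φ y)) (i : Fin n) :
    matDeriv i (fun z => A (φ z)) y = ∑ c, jacobian φ y c i • matDeriv c A (φ y) := by
  ext a b
  rw [Matrix.sum_apply]
  exact pderiv_comp i (hA a b) ((hφ.differentiableOn (by simp)).differentiableAt
    (hV.mem_nhds hy))

namespace IsCoordMetric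

/-- The derivative of the metric coefficients, as a matrix. -/
lemma matDeriv_pullback (h : IsCoordMetric U G) (hV : IsOpen V) (hφ : ContDiffOn ℝ ∞ φ V)
    (hm : ∀ z ∈ V, φ z ∈ U) (hy : y ∈ V) (i : Fin n) :
    matDeriv i (pullback φ G) y
      = (matDeriv i (jacobian φ) y).transpose * G (φ y) * jacobian φ y
        + (jacobian φ y).transpose * (∑ c, jacobian φ y c i • matDeriv c G (φ y)) * jacobian φ y
        + (jacobian φ y).transpose * G (φ y) * matDeriv i (jacobian φ) y := by
  have hJ : ∀ a b, DifferentiableAt ℝ (fun z => jacobian φ z a b) y := fun a b =>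
    differentiableAt_of_contDiffOn hV hy (contDiffOn_jacobian hV hφ a b)
  have hφd : DifferentiableAt ℝ φ y :=
    (hφ.differentiableOn (by simp)).differentiableAt (hV.mem_nhds hy)
  have hG : ∀ a b, DifferentiableAt ℝ (fun z => G (φ z) a b) y := fun a b =>
    (h.differentiableAt (hm y hy) a b).comp y hφd
  have hJG : ∀ a b, DifferentiableAt ℝ
      (fun z => ((jacobian φ z).transpose * G (φ z)) a b) y := by
    intro a b
    simp only [Matrix.mul_apply]
    exact DifferentiableAt.fun_sum fun c _ => (hJ c a).fun_mul (hG c b)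
  have e1 := matDeriv_mul hJG hJ i
  have e2 := matDeriv_mul (A := fun z => (jacobian φ z).transpose) (fun a b => hJ b a) hG i
  have e3 : matDeriv i (fun z => (jacobian φ z).transpose) y
      = (matDeriv i (jacobian φ) y).transpose := rfl
  rw [e2, e3, matDeriv_comp hV hy hφ (h.differentiableAt (hm y hy)), add_mul] at e1
  exact e1

lemma det_jacobian_ne (h' : IsCoordMetric V (pullback φ G)) (hy : y ∈ V) :
    (jacobian φ y).det ≠ 0 := by
  intro h0
  apply h'.det_ne y hy
  rw [pullback, Matrix.det_mul, h0, mul_zero]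

/-- The transformation law of the Christoffel symbols,
`J^a_k Γ'^k_{ij} = Γ^a_{bc} J^b_i J^c_j + ∂_i J^a_j`. -/
lemma jacobian_mul_connMat (h : IsCoordMetric U G) (h' : IsCoordMetric V (pullback φ G))
    (hφ : ContDiffOn ℝ ∞ φ V) (hm : ∀ z ∈ V, φ z ∈ U) (hy : y ∈ V) (i : Fin n) :
    jacobian φ y * connMat (pullback φ G) i y
      = (∑ c, jacobian φ y c i • connMat G c (φ y)) * jacobian φ y
        + matDeriv i (jacobian φ) y := by
  have hV := h'.isOpen
  have hJu : IsUnit (jacobian φ y).det := (h'.det_jacobian_ne hy).isUnit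
  set Z := (∑ c, jacobian φ y c i • connMat G c (φ y)) * jacobian φ y
        + matDeriv i (jacobian φ) y with hZ
  suffices hs : connMat (pullback φ G) i y = (jacobian φ y)⁻¹ * Z by
    rw [hs, ← mul_assoc, Matrix.mul_nonsing_inv _ hJu, one_mul]
  ext k j
  refine h'.eq_christoffel hy i j (X := fun k => ((jacobian φ y)⁻¹ * Z) k j) (fun l => ?_) k
  rw [← Matrix.mul_apply]
  have e1 : pullback φ G y * ((jacobian φ y)⁻¹ * Z) = (jacobian φ y).transpose * G (φ y) * Z := by
    rw [pullback, mul_assoc, ← mul_assoc (jacobian φ y), Matrix.mul_nonsing_inv _ hJu, one_mul]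
  have e2 : ∀ i j l, pderiv i (fun z => pullback φ G z j l) y
      = matDeriv i (pullback φ G) y j l := fun _ _ _ => rfl
  rw [e1, e2, e2, e2, hZ, mul_add]
  simp only [h.matDeriv_pullback hV hφ hm hy, Matrix.add_apply]
  set J := jacobian φ y with hJ
  -- the terms with second derivatives of `φ`
  have hflip : ∀ i j l, (J.transpose * G (φ y) * matDeriv i (jacobian φ) y) l j
      = ((matDeriv i (jacobian φ) y).transpose * G (φ y) * J) j l := by
    intro i j l
    rw [transpose_mul_mul_apply, transpose_mul_mul_apply, Finset.sum_comm]
    exact Finset.sum_congr rfl fun a _ => Finset.sum_congr rfl fun b _ => by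
      rw [h.symm _ (hm y hy) b a]; ring
  have hcomm : ∀ i j l, ((matDeriv i (jacobian φ) y).transpose * G (φ y) * J) j l
      = ((matDeriv j (jacobian φ) y).transpose * G (φ y) * J) i l := by
    intro i j l
    rw [transpose_mul_mul_apply, transpose_mul_mul_apply]
    exact Finset.sum_congr rfl fun a _ => Finset.sum_congr rfl fun b _ => by
      rw [matDeriv_jacobian_comm hV hφ hy]
  -- the terms with derivatives of `G`
  have hT : ∀ i j l, (J.transpose * (∑ c, J c i • matDeriv c G (φ y)) * J) j l
      = ∑ c, ∑ a, ∑ b, J c i * J a j * J b l * pderiv c (fun z => G z a b) (φ y) := by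
    intro i j l
    simp only [Finset.mul_sum, Finset.sum_mul, Matrix.sum_apply]
    refine Finset.sum_congr rfl fun c _ => ?_
    rw [transpose_mul_mul_apply]
    exact Finset.sum_congr rfl fun a _ => Finset.sum_congr rfl fun b _ => by
      simp only [Matrix.smul_apply, smul_eq_mul, matDeriv, Matrix.of_apply]
      ring
  have hL : (J.transpose * G (φ y) * ((∑ c, J c i • connMat G c (φ y)) * J)) l j
      = (1 / 2 : ℝ) * ((J.transpose * (∑ c, J c i • matDeriv c G (φ y)) * J) j l
        + (J.transpose * (∑ c, J c j • matDeriv c G (φ y)) * J) i l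
        - (J.transpose * (∑ c, J c l • matDeriv c G (φ y)) * J) i j) := by
    have e3 : J.transpose * G (φ y) * ((∑ c, J c i • connMat G c (φ y)) * J)
        = ∑ c, J c i • (J.transpose * (G (φ y) * connMat G c (φ y)) * J) := by
      simp only [Finset.sum_mul, Finset.mul_sum, Matrix.smul_mul, Matrix.mul_smul, mul_assoc]
    have e4 : ∀ c, (J.transpose * (G (φ y) * connMat G c (φ y)) * J) l j
        = ∑ a, ∑ b, J a l * ((1 / 2 : ℝ) * (pderiv c (fun z => G z b a) (φ y)
          + pderiv b (fun z => G z c a) (φ y) - pderiv a (fun z => G z c b) (φ y))) * J b j := by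
      intro c
      rw [transpose_mul_mul_apply]
      refine Finset.sum_congr rfl fun a _ => Finset.sum_congr rfl fun b _ => ?_
      rw [← h.lower_christoffel (hm y hy) a c b, Matrix.mul_apply]
      rfl
    rw [e3, Matrix.sum_apply]
    simp only [Matrix.smul_apply, smul_eq_mul, e4, hT]
    have t1 : ∑ c, ∑ a, ∑ b, J c i * J a j * J b l * pderiv c (fun z => G z a b) (φ y)
        = ∑ c, ∑ a, ∑ b, J c i * (J a l * J b j * pderiv c (fun z => G z b a) (φ y)) := by
      refine Finset.sum_congr rfl fun c _ => ?_
      rw [Finset.sum_comm]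
      exact Finset.sum_congr rfl fun a _ => Finset.sum_congr rfl fun b _ => by ring
    have t2 : ∑ c, ∑ a, ∑ b, J c j * J a i * J b l * pderiv c (fun z => G z a b) (φ y)
        = ∑ c, ∑ a, ∑ b, J c i * (J a l * J b j * pderiv b (fun z => G z c a) (φ y)) := by
      rw [Finset.sum_comm]
      refine Finset.sum_congr rfl fun c _ => ?_
      rw [Finset.sum_comm]
      exact Finset.sum_congr rfl fun a _ => Finset.sum_congr rfl fun b _ => by ring
    have t3 : ∑ c, ∑ a, ∑ b, J c l * J a i * J b j * pderiv c (fun z => G z a b) (φ y)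
        = ∑ c, ∑ a, ∑ b, J c i * (J a l * J b j * pderiv a (fun z => G z c b) (φ y)) := by
      rw [Finset.sum_comm]
      exact Finset.sum_congr rfl fun c _ => Finset.sum_congr rfl fun a _ =>
        Finset.sum_congr rfl fun b _ => by ring
    rw [t1, t2, t3]
    simp only [← Finset.sum_add_distrib, ← Finset.sum_sub_distrib, Finset.mul_sum]
    exact Finset.sum_congr rfl fun c _ => Finset.sum_congr rfl fun a _ =>
      Finset.sum_congr rfl fun b _ => by ring
  rw [hL, hflip i j l, hflip i l j, hflip j l i, hflip l j i, hcomm j i l, hcomm l i j,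
    hcomm l j i]
  ring

/-- The transformation law of the curvature tensor,
`J^c_l R'^l_{ijk} = R^c_{abd} J^a_i J^b_j J^d_k`. -/
lemma jacobian_mul_curvMat (h : IsCoordMetric U G) (h' : IsCoordMetric V (pullback φ G))
    (hφ : ContDiffOn ℝ ∞ φ V) (hm : ∀ z ∈ V, φ z ∈ U) (hy : y ∈ V) (i j : Fin n) :
    jacobian φ y * curvMat (pullback φ G) i j y
      = (∑ a, ∑ b, (jacobian φ y a i * jacobian φ y b j) • curvMat G a b (φ y))
        * jacobian φ y := by
  have hV := h'.isOpen
  have hφd : DifferentiableAt ℝ φ y :=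
    (hφ.differentiableOn (by simp)).differentiableAt (hV.mem_nhds hy)
  have hJ : ∀ a b, DifferentiableAt ℝ (fun z => jacobian φ z a b) y := fun a b =>
    differentiableAt_of_contDiffOn hV hy (contDiffOn_jacobian hV hφ a b)
  have hΓ : ∀ c a b, DifferentiableAt ℝ (fun z => connMat G c (φ z) a b) y := fun c a b =>
    (h.differentiableAt_christoffel (hm y hy) a c b).comp y hφd
  have hΓ' : ∀ c a b, DifferentiableAt ℝ (fun z => connMat (pullback φ G) c z a b) y :=
    fun c a b => h'.differentiableAt_christoffel hy a c b
  have hdJ : ∀ i a b, DifferentiableAt ℝ (fun z => matDeriv i (jacobian φ) z a b) y :=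
    fun i a b => differentiableAt_of_contDiffOn hV hy
      (contDiffOn_pderiv hV (contDiffOn_jacobian hV hφ a b) i)
  -- the pullback of the connection matrix of `G`
  obtain ⟨A, hA⟩ : ∃ A : Fin n → EuclideanSpace ℝ (Fin n) → Matrix (Fin n) (Fin n) ℝ,
    A = fun i z => ∑ c, jacobian φ z c i • connMat G c (φ z) := ⟨_, rfl⟩
  have hAd : ∀ i a b, DifferentiableAt ℝ (fun z => A i z a b) y := by
    intro i a b
    simp only [hA, Matrix.sum_apply, Matrix.smul_apply, smul_eq_mul]
    exact DifferentiableAt.fun_sum fun c _ => (hJ c i).fun_mul (hΓ c a b)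
  have hAJ : ∀ i a b, DifferentiableAt ℝ (fun z => (A i z * jacobian φ z) a b) y := by
    intro i a b
    simp only [Matrix.mul_apply]
    exact DifferentiableAt.fun_sum fun c _ => (hAd i a c).fun_mul (hJ c b)
  have hconn : ∀ i, ∀ z ∈ V, jacobian φ z * connMat (pullback φ G) i z
      = A i z * jacobian φ z + matDeriv i (jacobian φ) z := fun i z hz => by
    rw [hA]
    exact h.jacobian_mul_connMat h' hφ hm hz i
  -- the derivative of the transformation law of the Christoffel symbols
  have hder : ∀ k i, matDeriv k (jacobian φ) y * connMat (pullback φ G) i y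
        + jacobian φ y * matDeriv k (connMat (pullback φ G) i) y
      = matDeriv k (A i) y * jacobian φ y + A i y * matDeriv k (jacobian φ) y
        + matDeriv k (matDeriv i (jacobian φ)) y := by
    intro k i
    rw [← matDeriv_mul hJ (hΓ' i) k, ← matDeriv_mul (hAd i) hJ k, ← matDeriv_add (hAJ i) (hdJ i) k]
    exact matDeriv_congr hV hy k (hconn i)
  have hsymm : matDeriv i (matDeriv j (jacobian φ)) y = matDeriv j (matDeriv i (jacobian φ)) y := by
    ext a b
    exact pderiv_comm hV hy (contDiffOn_jacobian hV hφ a b) i j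
  have hdA : ∀ k i, matDeriv k (A i) y = ∑ a, matDeriv k (jacobian φ) y a i • connMat G a (φ y)
      + ∑ a, ∑ b, (jacobian φ y a i * jacobian φ y b k) • matDeriv b (connMat G a) (φ y) := by
    intro k i
    ext p q
    simp only [Matrix.add_apply, Matrix.sum_apply, Matrix.smul_apply, smul_eq_mul,
      ← Finset.sum_add_distrib]
    have : matDeriv k (A i) y p q
        = pderiv k (fun z => ∑ c, jacobian φ z c i * connMat G c (φ z) p q) y := by
      simp only [hA, matDeriv, Matrix.of_apply, Matrix.sum_apply, Matrix.smul_apply, smul_eq_mul]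
    rw [this, pderiv_sum _ _ fun c _ => (hJ c i).fun_mul (hΓ c p q)]
    refine Finset.sum_congr rfl fun c _ => ?_
    rw [pderiv_mul k (hJ c i) (hΓ c p q)]
    have hc := congrFun (congrFun (matDeriv_comp hV hy hφ (A := connMat G c)
      (fun a b => h.differentiableAt_christoffel (hm y hy) a c b) k) p) q
    rw [Matrix.sum_apply] at hc
    change pderiv k (fun z => connMat G c (φ z) p q) y = _ at hc
    rw [hc, Finset.mul_sum]
    congr 1
    exact Finset.sum_congr rfl fun b _ => by
      simp only [Matrix.smul_apply, smul_eq_mul]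
      ring
  -- the curvature of the pulled back connection matrix
  have hP : ∑ a, ∑ b, (jacobian φ y a i * jacobian φ y b j) • curvMat G a b (φ y)
      = matDeriv i (A j) y - matDeriv j (A i) y + (A i y * A j y - A j y * A i y) := by
    have q1 : ∑ a, matDeriv i (jacobian φ) y a j • connMat G a (φ y)
        = ∑ a, matDeriv j (jacobian φ) y a i • connMat G a (φ y) :=
      Finset.sum_congr rfl fun a _ => by rw [matDeriv_jacobian_comm hV hφ hy]
    have q2 : ∀ i j, A i y * A j y = ∑ a, ∑ b, (jacobian φ y a i * jacobian φ y b j) •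
        (connMat G a (φ y) * connMat G b (φ y)) := by
      intro i j
      simp only [hA, Finset.sum_mul, Finset.mul_sum, Matrix.smul_mul, Matrix.mul_smul, smul_smul]
      rw [Finset.sum_comm]
      exact Finset.sum_congr rfl fun a _ => Finset.sum_congr rfl fun b _ => by
        rw [mul_comm]
    have q3 : A j y * A i y = ∑ a, ∑ b, (jacobian φ y a i * jacobian φ y b j) •
        (connMat G b (φ y) * connMat G a (φ y)) := by
      rw [q2 j i, Finset.sum_comm]
      exact Finset.sum_congr rfl fun a _ => Finset.sum_congr rfl fun b _ => by
        rw [mul_comm (jacobian φ y b j)]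
    have q4 : ∑ a, ∑ b, (jacobian φ y a j * jacobian φ y b i) • matDeriv b (connMat G a) (φ y)
        = ∑ a, ∑ b, (jacobian φ y a i * jacobian φ y b j) • matDeriv a (connMat G b) (φ y) := by
      rw [Finset.sum_comm]
      exact Finset.sum_congr rfl fun a _ => Finset.sum_congr rfl fun b _ => by
        rw [mul_comm (jacobian φ y b j)]
    rw [hdA, hdA, q1, q4, q2 i j, q3]
    simp only [curvMat_eq, smul_add, smul_sub, Finset.sum_add_distrib, Finset.sum_sub_distrib]
    abel
  rw [hP, curvMat_eq]
  have d1 := hder i j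
  have d2 := hder j i
  have c1 := hconn i y hy
  have c2 := hconn j y hy
  rw [hsymm] at d1
  set J := jacobian φ y
  set Γi := connMat (pullback φ G) i y
  set Γj := connMat (pullback φ G) j y
  have d1' : J * matDeriv i (connMat (pullback φ G) j) y = matDeriv i (A j) y * J
      + A j y * matDeriv i (jacobian φ) y + matDeriv j (matDeriv i (jacobian φ)) y
      - matDeriv i (jacobian φ) y * Γj := by
    rw [← d1]; abel
  have d2' : J * matDeriv j (connMat (pullback φ G) i) y = matDeriv j (A i) y * J
      + A i y * matDeriv j (jacobian φ) y + matDeriv j (matDeriv i (jacobian φ)) y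
      - matDeriv j (jacobian φ) y * Γi := by
    rw [← d2]; abel
  have m1 : J * (Γi * Γj) = A i y * (A j y * J + matDeriv j (jacobian φ) y)
      + matDeriv i (jacobian φ) y * Γj := by
    rw [← mul_assoc, c1, add_mul, mul_assoc, c2]
  have m2 : J * (Γj * Γi) = A j y * (A i y * J + matDeriv i (jacobian φ) y)
      + matDeriv j (jacobian φ) y * Γi := by
    rw [← mul_assoc, c2, add_mul, mul_assoc, c1]
  rw [mul_add, mul_sub, mul_sub, d1', d2', m1, m2]
  noncomm_ring

/-- The Ricci tensor is a tensor. -/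
lemma ricci_pullback (h : IsCoordMetric U G) (h' : IsCoordMetric V (pullback φ G))
    (hφ : ContDiffOn ℝ ∞ φ V) (hm : ∀ z ∈ V, φ z ∈ U) (hy : y ∈ V) :
    (Matrix.of fun j k => ricci (pullback φ G) j k y)
      = (jacobian φ y).transpose * (Matrix.of fun j k => ricci G j k (φ y)) * jacobian φ y := by
  have hJu : IsUnit (jacobian φ y).det := (h'.det_jacobian_ne hy).isUnit
  set J := jacobian φ y with hJ
  have hR : ∀ i j, curvMat (pullback φ G) i j y
      = ∑ a, ∑ b, (J a i * J b j) • (J⁻¹ * curvMat G a b (φ y) * J) := by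
    intro i j
    have := congrArg (fun X => J⁻¹ * X) (h.jacobian_mul_curvMat h' hφ hm hy i j)
    simp only [← hJ] at this
    rw [← mul_assoc, Matrix.nonsing_inv_mul _ hJu, one_mul] at this
    rw [this]
    simp only [Finset.sum_mul, Finset.mul_sum, Matrix.smul_mul, Matrix.mul_smul, mul_assoc]
  have hδ : ∀ a c, ∑ i, J a i * J⁻¹ i c = if a = c then 1 else 0 := fun a c => by
    rw [← Matrix.mul_apply, Matrix.mul_nonsing_inv _ hJu, Matrix.one_apply]
  ext j k
  have e1 : ∀ i, riemann (pullback φ G) i i j k y = curvMat (pullback φ G) i j y i k :=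
    fun _ => rfl
  have e2 : ∀ i a b, (J⁻¹ * curvMat G a b (φ y) * J) i k
      = ∑ c, J⁻¹ i c * (curvMat G a b (φ y) * J) c k := fun i a b => by
    rw [mul_assoc, Matrix.mul_apply]
  rw [transpose_mul_mul_apply]
  simp only [Matrix.of_apply, ricci, e1, hR, Matrix.sum_apply, Matrix.smul_apply, smul_eq_mul, e2]
  calc ∑ i, ∑ a, ∑ b, J a i * J b j * ∑ c, J⁻¹ i c * (curvMat G a b (φ y) * J) c k
      = ∑ a, ∑ b, ∑ c, (∑ i, J a i * J⁻¹ i c) * (J b j * (curvMat G a b (φ y) * J) c k) := by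
        rw [Finset.sum_comm]
        refine Finset.sum_congr rfl fun a _ => ?_
        rw [Finset.sum_comm]
        refine Finset.sum_congr rfl fun b _ => ?_
        simp only [Finset.mul_sum, Finset.sum_mul]
        rw [Finset.sum_comm]
        exact Finset.sum_congr rfl fun c _ => Finset.sum_congr rfl fun i _ => by ring
    _ = ∑ a, ∑ b, J b j * (curvMat G a b (φ y) * J) a k := by
        simp [hδ]
    _ = ∑ b, ∑ d, J b j * (∑ i, riemann G i i b d (φ y)) * J d k := by
        rw [Finset.sum_comm]
        refine Finset.sum_congr rfl fun b _ => ?_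
        simp only [Matrix.mul_apply, Finset.mul_sum, Finset.sum_mul]
        rw [Finset.sum_comm]
        exact Finset.sum_congr rfl fun d _ => Finset.sum_congr rfl fun a _ => by
          simp only [curvMat, Matrix.of_apply]
          ring

/-- The scalar curvature is invariant under changes of coordinates. -/
lemma coordScalar_pullback (h : IsCoordMetric U G) (h' : IsCoordMetric V (pullback φ G))
    (hφ : ContDiffOn ℝ ∞ φ V) (hm : ∀ z ∈ V, φ z ∈ U) (hy : y ∈ V) :
    coordScalar (pullback φ G) y = coordScalar G (φ y) := by
  have hJu : IsUnit (jacobian φ y).det := (h'.det_jacobian_ne hy).isUnit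
  have hJtu : IsUnit (jacobian φ y).transpose.det := by rwa [Matrix.det_transpose]
  have htr : ∀ {W : Set (EuclideanSpace ℝ (Fin n))} {K} {z : EuclideanSpace ℝ (Fin n)}
      (hK : IsCoordMetric W K) (hz : z ∈ W),
      coordScalar K z = ((K z)⁻¹ * (Matrix.of fun j k => ricci K j k z)).trace := by
    intro W K z hK hz
    simp only [coordScalar, Matrix.trace, Matrix.diag_apply, Matrix.mul_apply, Matrix.of_apply]
    rw [Finset.sum_comm]
    exact Finset.sum_congr rfl fun j _ => Finset.sum_congr rfl fun k _ => by
      rw [hK.inv_symm hz]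
  rw [htr h' hy, htr h (hm y hy), h.ricci_pullback h' hφ hm hy]
  set J := jacobian φ y with hJ
  set R : Matrix (Fin n) (Fin n) ℝ := Matrix.of fun j k => ricci G j k (φ y)
  have hinv : (pullback φ G y)⁻¹ = J⁻¹ * (G (φ y))⁻¹ * J.transpose⁻¹ := by
    rw [pullback, Matrix.mul_inv_rev, Matrix.mul_inv_rev, ← mul_assoc]
  calc ((pullback φ G y)⁻¹ * (J.transpose * R * J)).trace
      = (J⁻¹ * ((G (φ y))⁻¹ * (J.transpose⁻¹ * J.transpose) * R * J)).trace := by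
        rw [hinv]
        simp only [mul_assoc]
    _ = ((G (φ y))⁻¹ * (J.transpose⁻¹ * J.transpose) * R * (J * J⁻¹)).trace := by
        rw [Matrix.trace_mul_comm, mul_assoc]
    _ = ((G (φ y))⁻¹ * R).trace := by
        rw [Matrix.nonsing_inv_mul _ hJtu, Matrix.mul_nonsing_inv _ hJu, mul_one, mul_one]

end IsCoordMetric

end

/-! ### Scalar curvature and Laplacian on the manifold -/

section

section Local

variable {n : ℕ} {U V : Set (EuclideanSpace ℝ (Fin n))} {y : EuclideanSpace ℝ (Fin n)}
  {G G' : EuclideanSpace ℝ (Fin n) → Matrix (Fin n) (Fin n) ℝ}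
  {f₁ f₂ : EuclideanSpace ℝ (Fin n) → ℝ}

/-- The scalar curvature at a point depends only on the germ of the metric. -/
lemma coordScalar_congr (hU : IsOpen U) (h : ∀ z ∈ U, G z = G' z) (hy : y ∈ U) :
    coordScalar G y = coordScalar G' y := by
  have h1 : ∀ k i j, ∀ z ∈ U, christoffel G k i j z = christoffel G' k i j z := by
    intro k i j z hz
    have hp : ∀ a b c, pderiv a (fun z => G z b c) z = pderiv a (fun z => G' z b c) z :=
      fun a b c => pderiv_congr_of_eqOn hU hz a fun z hz => by rw [h z hz]
    simp only [christoffel, h z hz, hp]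
  have h2 : ∀ i k a b, pderiv i (christoffel G k a b) y = pderiv i (christoffel G' k a b) y :=
    fun i k a b => pderiv_congr_of_eqOn hU hy i (h1 k a b)
  simp only [coordScalar, ricci, riemann, h2, h1 _ _ _ y hy, h y hy]

lemma IsCoordMetric.mono (h : IsCoordMetric U G) (hV : IsOpen V) (hVU : V ⊆ U)
    (hG : ∀ z ∈ V, G z = G' z) : IsCoordMetric V G' where
  isOpen := hV
  symm y hy i j := by
    rw [← hG y hy]
    exact h.symm y (hVU hy) i j
  smooth i j := ((h.smooth i j).mono hVU).congr fun z hz => by rw [hG z hz]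
  det_ne y hy := by
    rw [← hG y hy]
    exact h.det_ne y (hVU hy)

lemma coordLaplacian_congr (h : f₁ =ᶠ[𝓝 y] f₂) : coordLaplacian G f₁ y = coordLaplacian G f₂ y := by
  have h1 : ∀ j, pderiv j f₁ =ᶠ[𝓝 y] pderiv j f₂ := fun j =>
    h.fderiv.mono fun z hz => by rw [pderiv, pderiv, hz]
  simp only [coordLaplacian, pderiv_congr _ (h1 _), pderiv_congr _ h]

/-- At its critical point `y`, the function `z ↦ 1 + C |z - y|²` has Laplacian `2 C tr G⁻¹`. -/
lemma coordLaplacian_paraboloid (C : ℝ) :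
    coordLaplacian G (fun z => 1 + C * ‖z - y‖ ^ 2) y = 2 * C * ((G y)⁻¹).trace := by
  have h1 : ∀ j, pderiv j (fun z => 1 + C * ‖z - y‖ ^ 2) = fun z => 2 * C * (z j - y j) := by
    intro j
    ext z
    have hd : HasFDerivAt (fun z => z - y) (ContinuousLinearMap.id ℝ _) z :=
      (hasFDerivAt_id z).sub_const y
    have := ((hd.norm_sq.const_mul C).const_add 1).fderiv
    rw [pderiv, this]
    simp [EuclideanSpace.inner_single_right]
    ring
  have h2 : ∀ i j, pderiv i (fun z => 2 * C * (z j - y j)) y = 2 * C * if i = j then 1 else 0 := by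
    intro i j
    have hd := ((EuclideanSpace.proj (𝕜 := ℝ) j).hasFDerivAt (x := y)).sub_const (y j)
    have := (hd.const_mul (2 * C)).fderiv
    change fderiv ℝ (fun z : EuclideanSpace ℝ (Fin n) => 2 * C * (z j - y j)) y = _ at this
    rw [pderiv, this]
    simp [eq_comm]
  simp only [coordLaplacian, h1, h2, sub_self, mul_zero, Finset.sum_const_zero, sub_zero]
  simp only [mul_ite, mul_one, mul_zero, Finset.sum_ite_eq, Finset.mem_univ, if_true,
    Matrix.trace, Matrix.diag_apply, Finset.mul_sum]
  exact Finset.sum_congr rfl fun i _ => by ring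

end Local

variable {n : ℕ} {M : Type*} [TopologicalSpace M]
  [ChartedSpace (EuclideanSpace ℝ (Fin n)) M] [IsManifold (𝓡 n) ∞ M]

lemma contDiffOn_chartMetric (g : SmoothMetric n M) (x : M) (i j : Fin n) :
    ContDiffOn ℝ ∞ (fun y => chartMetric g x y i j) (extChartAt (𝓡 n) x).target := by
  set T := (extChartAt (𝓡 n) x).target with hT
  have hTo : IsOpen T := isOpen_extChartAt_target x
  have hs : ContMDiffOn 𝓘(ℝ, EuclideanSpace ℝ (Fin n)) (𝓡 n) ∞ (extChartAt (𝓡 n) x).symm T :=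
    contMDiffOn_extChartAt_symm x
  -- the coordinate vector fields are smooth
  have hv : ∀ i : Fin n, ContMDiffOn 𝓘(ℝ, EuclideanSpace ℝ (Fin n)) ((𝓡 n).tangent) ∞
      (fun y => (TotalSpace.mk' (EuclideanSpace ℝ (Fin n)) ((extChartAt (𝓡 n) x).symm y)
        (mfderiv 𝓘(ℝ, EuclideanSpace ℝ (Fin n)) (𝓡 n) (extChartAt (𝓡 n) x).symm y
        (EuclideanSpace.single i (1 : ℝ))) : TangentBundle (𝓡 n) M)) T := by
    intro i
    have h1 := hs.contMDiffOn_tangentMapWithin (m := ∞) (by simp) hTo.uniqueMDiffOn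
    have h2 : ContMDiffOn 𝓘(ℝ, EuclideanSpace ℝ (Fin n))
        (𝓘(ℝ, EuclideanSpace ℝ (Fin n)).tangent) ∞
        (fun y => (⟨y, EuclideanSpace.single i (1 : ℝ)⟩ :
          TangentBundle 𝓘(ℝ, EuclideanSpace ℝ (Fin n)) (EuclideanSpace ℝ (Fin n)))) T :=
      contMDiffOn_vectorSpace_iff_contDiffOn.2 contDiffOn_const
    refine (h1.comp h2 fun y hy => hy).congr fun y hy => ?_
    simp only [Function.comp, tangentMapWithin]
    rw [mfderivWithin_of_isOpen hTo hy]
  rw [← contMDiffOn_iff_contDiffOn]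
  intro y hy
  have : ContMDiffWithinAt 𝓘(ℝ, EuclideanSpace ℝ (Fin n)) ((𝓡 n).prod 𝓘(ℝ)) ∞
      (fun m ↦ TotalSpace.mk' ℝ (E := Bundle.Trivial M ℝ) ((extChartAt (𝓡 n) x).symm m)
        (chartMetric g x m i j)) T y := by
    apply ContMDiffWithinAt.clm_bundle_apply₂ (F₁ := EuclideanSpace ℝ (Fin n))
      (F₂ := EuclideanSpace ℝ (Fin n))
    · exact ContMDiffAt.comp_contMDiffWithinAt y g.contMDiff.contMDiffAt (hs y hy)
    · exact hv i y hy
    · exact hv j y hy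
  simp only [contMDiffWithinAt_totalSpace] at this
  exact this.2

/-- The metric on linear combinations of the coordinate vector fields. -/
lemma inner_mfderiv_chart_symm (g : SmoothMetric n M) (x : M) (y : EuclideanSpace ℝ (Fin n))
    (v w : EuclideanSpace ℝ (Fin n)) :
    g.inner ((extChartAt (𝓡 n) x).symm y)
      (mfderiv 𝓘(ℝ, EuclideanSpace ℝ (Fin n)) (𝓡 n) (extChartAt (𝓡 n) x).symm y v)
      (mfderiv 𝓘(ℝ, EuclideanSpace ℝ (Fin n)) (𝓡 n) (extChartAt (𝓡 n) x).symm y w)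
    = ∑ i, ∑ j, v i * chartMetric g x y i j * w j := by
  have hb : ∀ v : EuclideanSpace ℝ (Fin n), v = ∑ a, v a • EuclideanSpace.single a (1 : ℝ) := by
    intro v
    have := (EuclideanSpace.basisFun (Fin n) ℝ).sum_repr v
    simpa using this.symm
  -- the bilinear form on the model space
  let A : EuclideanSpace ℝ (Fin n) →L[ℝ] EuclideanSpace ℝ (Fin n) :=
    mfderiv 𝓘(ℝ, EuclideanSpace ℝ (Fin n)) (𝓡 n) (extChartAt (𝓡 n) x).symm y
  let B : EuclideanSpace ℝ (Fin n) →L[ℝ] EuclideanSpace ℝ (Fin n) →L[ℝ] ℝ :=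
    g.inner ((extChartAt (𝓡 n) x).symm y)
  change B (A v) (A w) = ∑ i, ∑ j, v i
    * B (A (EuclideanSpace.single i 1)) (A (EuclideanSpace.single j 1)) * w j
  conv_lhs => rw [hb v, hb w]
  simp only [map_sum, map_smul, sum_apply, _root_.smul_apply, smul_eq_mul, Finset.mul_sum]
  rw [Finset.sum_comm]
  exact Finset.sum_congr rfl fun i _ => Finset.sum_congr rfl fun j _ => by ring

lemma chartMetric_posDef (g : SmoothMetric n M) (x : M) {y : EuclideanSpace ℝ (Fin n)}
    (hy : y ∈ (extChartAt (𝓡 n) x).target) : (chartMetric g x y).PosDef := by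
  refine Matrix.PosDef.of_dotProduct_mulVec_pos ?_ ?_
  · ext i j
    exact g.symm _ _ _
  · intro v hv
    have h1 := inner_mfderiv_chart_symm g x y (WithLp.toLp 2 v) (WithLp.toLp 2 v)
    have h2 : star v ⬝ᵥ (chartMetric g x y).mulVec v
        = ∑ i, ∑ j, v i * chartMetric g x y i j * v j := by
      simp only [dotProduct, Matrix.mulVec, Finset.mul_sum, star_trivial]
      exact Finset.sum_congr rfl fun i _ => Finset.sum_congr rfl fun j _ => by ring
    rw [h2]
    refine lt_of_lt_of_eq (g.pos _ _ ?_) h1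
    have hinv := isInvertible_mfderivWithin_extChartAt_symm (I := 𝓡 n) (x := x) hy
    rw [ModelWithCorners.range_eq_univ, mfderivWithin_univ] at hinv
    obtain ⟨e, he⟩ := hinv
    rw [← he]
    intro h0
    apply hv
    have := e.map_eq_zero_iff.1 h0
    exact congrArg (WithLp.ofLp (p := 2)) this

lemma isCoordMetric_chartMetric (g : SmoothMetric n M) (x : M) :
    IsCoordMetric (extChartAt (𝓡 n) x).target (chartMetric g x) where
  isOpen := isOpen_extChartAt_target x
  symm _ _ _ _ := g.symm _ _ _
  smooth := contDiffOn_chartMetric g x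
  det_ne _ hy := (chartMetric_posDef g x hy).det_pos.ne'

/-- The metric coefficients in two charts are related by the transition map. -/
lemma chartMetric_eq_pullback (g : SmoothMetric n M) (x x₀ : M) {y : EuclideanSpace ℝ (Fin n)}
    (hy : y ∈ ((extChartAt (𝓡 n) x).symm ≫ extChartAt (𝓡 n) x₀).source) :
    chartMetric g x y
      = pullback (extChartAt (𝓡 n) x₀ ∘ (extChartAt (𝓡 n) x).symm) (chartMetric g x₀) y := by
  set φ := extChartAt (𝓡 n) x₀ ∘ (extChartAt (𝓡 n) x).symm with hφ
  have hyT : y ∈ (extChartAt (𝓡 n) x).target := hy.1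
  have hys : (extChartAt (𝓡 n) x).symm y ∈ (extChartAt (𝓡 n) x₀).source := hy.2
  have hVo : IsOpen ((extChartAt (𝓡 n) x).symm ≫ extChartAt (𝓡 n) x₀).source :=
    (continuousOn_extChartAt_symm x).isOpen_inter_preimage (isOpen_extChartAt_target x)
      (isOpen_extChartAt_source x₀)
  have hφd : DifferentiableAt ℝ φ y :=
    ((contDiffOn_ext_coord_change (I := 𝓡 n) (n := ∞) x₀ x).differentiableOn
      (by simp)).differentiableAt (hVo.mem_nhds hy)
  have hpt : (extChartAt (𝓡 n) x₀).symm (φ y) = (extChartAt (𝓡 n) x).symm y :=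
    (extChartAt (𝓡 n) x₀).left_inv hys
  have hφT : φ y ∈ (extChartAt (𝓡 n) x₀).target := (extChartAt (𝓡 n) x₀).map_source hys
  have hev : (extChartAt (𝓡 n) x).symm =ᶠ[𝓝 y] (extChartAt (𝓡 n) x₀).symm ∘ φ :=
    Filter.eventuallyEq_of_mem (hVo.mem_nhds hy) fun z hz =>
      ((extChartAt (𝓡 n) x₀).left_inv hz.2).symm
  have hsd : MDifferentiableAt 𝓘(ℝ, EuclideanSpace ℝ (Fin n)) (𝓡 n)
      (extChartAt (𝓡 n) x₀).symm (φ y) :=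
    ((contMDiffOn_extChartAt_symm (n := ∞) x₀).contMDiffAt
      ((isOpen_extChartAt_target x₀).mem_nhds hφT)).mdifferentiableAt (by simp)
  have hder : ∀ v : EuclideanSpace ℝ (Fin n),
      (mfderiv 𝓘(ℝ, EuclideanSpace ℝ (Fin n)) (𝓡 n) (extChartAt (𝓡 n) x).symm y v :
        EuclideanSpace ℝ (Fin n))
      = mfderiv 𝓘(ℝ, EuclideanSpace ℝ (Fin n)) (𝓡 n) (extChartAt (𝓡 n) x₀).symm (φ y)
        (fderiv ℝ φ y v) := by
    intro v
    rw [hev.mfderiv_eq, mfderiv_comp y hsd hφd.mdifferentiableAt, mfderiv_eq_fderiv]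
    rfl
  have hJ : ∀ a i, (fderiv ℝ φ y (EuclideanSpace.single i 1)) a = jacobian φ y a i := by
    intro a i
    have := (((EuclideanSpace.proj (𝕜 := ℝ) a).hasFDerivAt (x := φ y)).comp y
      hφd.hasFDerivAt).fderiv
    change fderiv ℝ (fun z => φ z a) y = _ at this
    change _ = fderiv ℝ (fun z => φ z a) y _
    rw [this]
    rfl
  ext i j
  have h1 := inner_mfderiv_chart_symm g x₀ (φ y) (fderiv ℝ φ y (EuclideanSpace.single i 1))
    (fderiv ℝ φ y (EuclideanSpace.single j 1))
  rw [pullback, transpose_mul_mul_apply]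
  simp only [← hJ]
  rw [← h1]
  -- both sides as values of one bilinear form on the model space, at equal base points
  let B : M → EuclideanSpace ℝ (Fin n) →L[ℝ] EuclideanSpace ℝ (Fin n) →L[ℝ] ℝ :=
    fun p => g.inner p
  change B _ (mfderiv 𝓘(ℝ, EuclideanSpace ℝ (Fin n)) (𝓡 n) (extChartAt (𝓡 n) x).symm y _ :
        EuclideanSpace ℝ (Fin n))
      (mfderiv 𝓘(ℝ, EuclideanSpace ℝ (Fin n)) (𝓡 n) (extChartAt (𝓡 n) x).symm y _ :
        EuclideanSpace ℝ (Fin n)) = B _ _ _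
  rw [hder, hder, hpt]

/-- The scalar curvature at `x` may be computed in the preferred chart at `x₀` instead of the one at
`x`. -/
lemma scalarCurvature_eq_coordScalar (g : SmoothMetric n M) (x₀ : M) {x : M}
    (hx : x ∈ (extChartAt (𝓡 n) x₀).source) :
    scalarCurvature g x = coordScalar (chartMetric g x₀) (extChartAt (𝓡 n) x₀ x) := by
  set φ := extChartAt (𝓡 n) x₀ ∘ (extChartAt (𝓡 n) x).symm with hφ
  set V := ((extChartAt (𝓡 n) x).symm ≫ extChartAt (𝓡 n) x₀).source with hV
  have hVo : IsOpen V :=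
    (continuousOn_extChartAt_symm x).isOpen_inter_preimage (isOpen_extChartAt_target x)
      (isOpen_extChartAt_source x₀)
  have hxV : extChartAt (𝓡 n) x x ∈ V := by
    refine ⟨mem_extChartAt_target x, ?_⟩
    change (extChartAt (𝓡 n) x).symm (extChartAt (𝓡 n) x x) ∈ (extChartAt (𝓡 n) x₀).source
    rwa [extChartAt_to_inv]
  have hG : ∀ z ∈ V, chartMetric g x z = pullback φ (chartMetric g x₀) z := fun z hz =>
    chartMetric_eq_pullback g x x₀ hz
  have h' : IsCoordMetric V (pullback φ (chartMetric g x₀)) :=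
    (isCoordMetric_chartMetric g x).mono hVo (fun z hz => hz.1) hG
  rw [scalarCurvature, coordScalar_congr hVo hG hxV,
    (isCoordMetric_chartMetric g x₀).coordScalar_pullback h'
      (contDiffOn_ext_coord_change (I := 𝓡 n) (n := ∞) x₀ x)
      (fun z hz => (extChartAt (𝓡 n) x₀).map_source hz.2) hxV]
  congr 1
  simp only [hφ, Function.comp, extChartAt_to_inv]

/-- Near `x₀` the scalar curvature is read off in the single chart at `x₀`. -/
lemma contMDiff_scalarCurvature (g : SmoothMetric n M) :
    ContMDiff (𝓡 n) 𝓘(ℝ) ∞ (scalarCurvature g) := by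
  intro x₀
  have h1 : ContMDiffOn (𝓡 n) 𝓘(ℝ) ∞
      (fun x => coordScalar (chartMetric g x₀) (extChartAt (𝓡 n) x₀ x))
      (extChartAt (𝓡 n) x₀).source := by
    have h2 := (isCoordMetric_chartMetric g x₀).contDiffOn_coordScalar.contMDiffOn
    have h3 : ContMDiffOn (𝓡 n) 𝓘(ℝ, EuclideanSpace ℝ (Fin n)) ∞ (extChartAt (𝓡 n) x₀)
        (extChartAt (𝓡 n) x₀).source := by
      rw [extChartAt_source]
      exact contMDiffOn_extChartAt
    exact h2.comp h3 fun x hx => (extChartAt (𝓡 n) x₀).map_source hx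
  exact (h1.congr fun x hx => scalarCurvature_eq_coordScalar g x₀ hx).contMDiffAt
    (extChartAt_source_mem_nhds x₀)

/-- The conformal transformation law of the scalar curvature on `M`. -/
lemma scalarCurvature_conformalMetric (hn : 3 ≤ n) (g : SmoothMetric n M) (u : M → ℝ)
    (hu : ContMDiff (𝓡 n) 𝓘(ℝ) ∞ u) (hpos : ∀ x, 0 < u x) (x : M) :
    scalarCurvature (conformalMetric g u hu hpos) x * u x ^ (yamabeP n - 1)
      = -yamabeA n * laplacian g u x + scalarCurvature g x * u x := by
  have hus : ContDiffOn ℝ ∞ (u ∘ (extChartAt (𝓡 n) x).symm) (extChartAt (𝓡 n) x).target :=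
    contMDiffOn_iff_contDiffOn.1
      (hu.comp_contMDiffOn (contMDiffOn_extChartAt_symm (n := ∞) x))
  have h := (isCoordMetric_chartMetric g x).coordScalar_yamabe hn hus (fun _ _ => hpos _)
    (mem_extChartAt_target x)
  simp only [Function.comp_apply, extChartAt_to_inv] at h
  exact h

lemma yamabeA_pos (hn : 3 ≤ n) : 0 < yamabeA n := by
  have hn3 : (3 : ℝ) ≤ n := by exact_mod_cast hn
  exact div_pos (by linarith) (by linarith)

/-- Every value of the Laplacian `≥ 0` at a point is taken by a smooth function `≥ 1`
which is `1` at that point. -/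
lemma exists_laplacian_eq [T2Space M] (hn : 0 < n) (g : SmoothMetric n M) (q : M) {L : ℝ}
    (hL : 0 ≤ L) :
    ∃ u : M → ℝ, ContMDiff (𝓡 n) 𝓘(ℝ) ∞ u ∧ (∀ x, 1 ≤ u x) ∧ u q = 1 ∧ laplacian g u q = L := by
  have : Nonempty (Fin n) := ⟨⟨0, hn⟩⟩
  have htr : 0 < ((chartMetric g q (extChartAt (𝓡 n) q q))⁻¹).trace :=
    (chartMetric_posDef g q (mem_extChartAt_target q)).inv.trace_pos
  set t := ((chartMetric g q (extChartAt (𝓡 n) q q))⁻¹).trace with ht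
  obtain ⟨f⟩ : Nonempty (SmoothBumpFunction (𝓡 n) q) := inferInstance
  set y₀ := extChartAt (𝓡 n) q q with hy₀
  have hsq : ContMDiffOn (𝓡 n) 𝓘(ℝ) ∞ (fun x => ‖extChartAt (𝓡 n) q x - y₀‖ ^ 2)
      (chartAt (EuclideanSpace ℝ (Fin n)) q).source := by
    have h1 : ContDiff ℝ ∞ (fun z : EuclideanSpace ℝ (Fin n) => ‖z - y₀‖ ^ 2) :=
      (contDiff_id.sub contDiff_const).norm_sq ℝ
    exact h1.contMDiff.comp_contMDiffOn contMDiffOn_extChartAt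
  have hsm := f.contMDiff_smul hsq
  refine ⟨fun x => 1 + L / (2 * t) * (f x • ‖extChartAt (𝓡 n) q x - y₀‖ ^ 2),
    contMDiff_const.add (contMDiff_const.mul hsm), fun x => ?_, ?_, ?_⟩
  · have h1 : 0 ≤ f x := f.nonneg
    have h2 : 0 ≤ L / (2 * t) * (f x • ‖extChartAt (𝓡 n) q x - y₀‖ ^ 2) := by
      rw [smul_eq_mul]
      positivity
    linarith
  · simp [hy₀]
  · have hc : Filter.Tendsto (extChartAt (𝓡 n) q).symm (𝓝 y₀) (𝓝 q) := by
      have := continuousAt_extChartAt_symm (I := 𝓡 n) q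
      rwa [ContinuousAt, extChartAt_to_inv] at this
    have hev : ((fun x => 1 + L / (2 * t) * (f x • ‖extChartAt (𝓡 n) q x - y₀‖ ^ 2))
        ∘ (extChartAt (𝓡 n) q).symm) =ᶠ[𝓝 y₀] fun z => 1 + L / (2 * t) * ‖z - y₀‖ ^ 2 := by
      filter_upwards [hc.eventually f.eventuallyEq_one, extChartAt_target_mem_nhds (I := 𝓡 n) q]
        with z hz hzT
      have hz' : f ((extChartAt (𝓡 n) q).symm z) = 1 := hz
      rw [Function.comp_apply, hz', (extChartAt (𝓡 n) q).right_inv hzT, one_smul]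
    rw [laplacian, coordLaplacian_congr hev, coordLaplacian_paraboloid]
    rw [← ht]
    field_simp

end

end ConformalScalar

theorem mainTheorem5 (n : ℕ) (hn : 3 ≤ n) {M : Type*} [TopologicalSpace M] [T2Space M]
    [CompactSpace M] [Nonempty M] [ChartedSpace (EuclideanSpace ℝ (Fin n)) M]
    [IsManifold (𝓡 n) ∞ M] (g : ConformalScalar.SmoothMetric n M)
    (hS : ∀ x, 0 ≤ ConformalScalar.scalarCurvature g x) :
    (∃ H : M → ℝ, ContMDiff (𝓡 n) 𝓘(ℝ) ∞ H ∧ (∃ q, H q < 0) ∧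
      ∃ (u : M → ℝ) (hu : ContMDiff (𝓡 n) 𝓘(ℝ) ∞ u) (hpos : ∀ x, 0 < u x),
        (∀ x, ConformalScalar.scalarCurvature
            (ConformalScalar.conformalMetric g u hu hpos) x = H x) ∧
        ∀ x, -ConformalScalar.yamabeA n * ConformalScalar.laplacian g u x
            + ConformalScalar.scalarCurvature g x * u x
          = H x * u x ^ (ConformalScalar.yamabeP n - 1)) ∧
    (∀ H : M → ℝ, ContMDiff (𝓡 n) 𝓘(ℝ) ∞ H →
      ∀ (u : M → ℝ) (hu : ContMDiff (𝓡 n) 𝓘(ℝ) ∞ u) (hpos : ∀ x, 0 < u x),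
        (∀ x, ConformalScalar.scalarCurvature
            (ConformalScalar.conformalMetric g u hu hpos) x = H x) ↔
        ∀ x, -ConformalScalar.yamabeA n * ConformalScalar.laplacian g u x
            + ConformalScalar.scalarCurvature g x * u x
          = H x * u x ^ (ConformalScalar.yamabeP n - 1)) := by
  refine ⟨?_, fun H _ u hu hpos => ?_⟩
  · obtain ⟨q⟩ : Nonempty M := inferInstance
    have hA := ConformalScalar.yamabeA_pos hn
    have hL : 0 ≤ (ConformalScalar.scalarCurvature g q + 1) / ConformalScalar.yamabeA n :=
      div_nonneg (by linarith [hS q]) hA.le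
    -- for this value of `Δu(q)` and `u(q) = 1`, the new scalar curvature at `q` is `-1`
    obtain ⟨u, hu, hu1, huq, huL⟩ := ConformalScalar.exists_laplacian_eq (by omega) g q hL
    have hpos : ∀ x, 0 < u x := fun x => zero_lt_one.trans_le (hu1 x)
    have hlaw := ConformalScalar.scalarCurvature_conformalMetric hn g u hu hpos
    refine ⟨_, ConformalScalar.contMDiff_scalarCurvature
      (ConformalScalar.conformalMetric g u hu hpos), ⟨q, ?_⟩, u, hu, hpos, fun _ => rfl,
      fun x => (hlaw x).symm⟩
    have h1 := hlaw q
    have h2 : -ConformalScalar.yamabeA n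
        * ((ConformalScalar.scalarCurvature g q + 1) / ConformalScalar.yamabeA n)
        = -(ConformalScalar.scalarCurvature g q + 1) := by
      field_simp
    rw [huL, huq, Real.one_rpow, h2] at h1
    linarith
  · refine forall_congr' fun x => ?_
    rw [← ConformalScalar.scalarCurvature_conformalMetric hn g u hu hpos x]
    exact (mul_left_inj' (Real.rpow_pos_of_pos (hpos x) _).ne').symm
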